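/- All posets are finite and have a unique minimal element $\hat 0$ and a unique maximal element $\hat 1$. A graded poset with rank function $\rho$ is a \emph{Sheffer poset} if any two intervals $[\hat 0,y]$, $[\hat 0,v]$ with $\rho(y)=\rho(v)=n$ have the same number $D(n)$ of maximal chains, and any two intervals $[x,y]$, $[u,v]$ with $x,u\neq\hat 0$ and $\rho(y)-\rho(x)=\rho(v)-\rho(u)=n$ have the same number $B(n)$ of maximal chains; $B$ and $D$ are its binomial and Sheffer factorial functions. It is \emph{Eulerian} if every non-singleton interval has as many elements of even rank as of odd rank. Let $B_n$ (with a subscript) denote the boolean lattice of all subsets of $\{1,\dots,n\}$, let $\boxplus^{\alpha}(Q)$ denote the poset obtained from $\alpha$ copies of $Q$ by identifying all the minimal elements and identifying all the maximal elements, and let the dual suspension $\Sigma^{*}(Q)$ be the poset obtained from $Q$ by adding two new incomparable elements $a_1,a_2$ with $\hat 0<a_i<y$ for all $y>\hat 0$ in $Q$. \textbf{Theorem.} Let $P$ be an Eulerian Sheffer poset of even rank $n=2m+2\ge 4$ with $B(3)=3!=6$ and $D(3)=4$. Then $\alpha=\dfrac{B(2m+1)}{(2m+1)!}$ is a positive integer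 and $P$ is isomorphic to $\Sigma^{*}\bigl(\boxplus^{\alpha}(B_{2m+1})\bigr)$. Moreover, $P$ has the following binomial and Sheffer factorial functions: \begin{itemize} \item $B(k)=k!$ for $1\le k\le 2m$, and $B(2m+1)=\alpha\,(2m+1)!$; \item $D(1)=1$, $D(k)=2\,(k-1)!$ for $2\le k\le 2m+1$, and $D(2m+2)=2\alpha\,(2m+1)!$. \end{itemize} -/

import Mathlib

/-- The number of maximal chains of the interval `[x, y]`. -/
noncomputable def numMaxChains {P : Type*} [PartialOrder P] (x y : P) : ℕ :=
  Nat.card (Flag (Set.Icc x y))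

/-- A graded poset is Eulerian if every non-singleton interval has as many elements of even rank
as elements of odd rank. (Counting ranks in `P` or inside the interval makes no difference: it
at most exchanges the two numbers.) -/
def IsEulerianPoset (P : Type*) [PartialOrder P] [GradeMinOrder ℕ P] : Prop :=
  ∀ x y : P, x < y →
    {z : P | z ∈ Set.Icc x y ∧ Even (grade ℕ z)}.ncard =
      {z : P | z ∈ Set.Icc x y ∧ Odd (grade ℕ z)}.ncard

/-- A (finite) Sheffer poset: the number of maximal chains of an interval `[⊥, y]` depends only on
the rank of `y`, and the number of maximal chains of an interval `[x, y]` with `x ≠ ⊥` depends only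
on the length of that interval. -/
structure IsShefferPoset (P : Type*) [PartialOrder P] [BoundedOrder P] [GradeMinOrder ℕ P] :
    Prop where
  finite : Finite P
  sheffer : ∀ y v : P, grade ℕ y = grade ℕ v → numMaxChains ⊥ y = numMaxChains ⊥ v
  binomial : ∀ x y u v : P, x ≠ ⊥ → u ≠ ⊥ → x ≤ y → u ≤ v →
    grade ℕ y - grade ℕ x = grade ℕ v - grade ℕ u → numMaxChains x y = numMaxChains u v

/-- `B` is the binomial factorial function of `P`: every `n`-interval `[x, y]` with `x ≠ ⊥` has
`B n` maximal chains. -/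
def IsBinomialFactorialFunction (P : Type*) [PartialOrder P] [BoundedOrder P] [GradeMinOrder ℕ P]
    (B : ℕ → ℕ) : Prop :=
  ∀ x y : P, x ≠ ⊥ → x ≤ y → numMaxChains x y = B (grade ℕ y - grade ℕ x)

/-- `D` is the Sheffer factorial function of `P`: every `n`-interval `[⊥, y]` has
`D n` maximal chains. -/
def IsShefferFactorialFunction (P : Type*) [PartialOrder P] [BoundedOrder P] [GradeMinOrder ℕ P]
    (D : ℕ → ℕ) : Prop :=
  ∀ y : P, numMaxChains ⊥ y = D (grade ℕ y)

/-- The boolean lattice of rank `n`: subsets of an `n`-element set, ordered by inclusion. -/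
abbrev BooleanLattice (n : ℕ) : Type := Finset (Fin n)

/-- The `k`-summation of a bounded poset `P` with `⊥ ≠ ⊤`: all minimal elements and all maximal
elements of `k` copies of `P` are identified. The order on the sigma type is that of a disjoint
union (elements of different copies are incomparable); `WithBot` and `WithTop` add the common least
and greatest elements. -/
abbrev KSummation (k : ℕ) (P : Type*) [PartialOrder P] [BoundedOrder P] [Nontrivial P] : Type _ :=
  WithBot (WithTop (Σ _ : Fin k, Set.Ioo (⊥ : P) ⊤))

/-- The dual suspension of a poset `P` with `⊥`: two new incomparable elements are inserted between
`⊥` and all other elements. Here `Unit ⊕ Unit` is the two-element antichain, and in the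
lexicographic (ordinal) sum it lies entirely below the part `(⊥, ∞)` of `P`. -/
abbrev DualSuspension (P : Type*) [PartialOrder P] [OrderBot P] : Type _ :=
  WithBot ((Unit ⊕ Unit) ⊕ₗ Set.Ioi (⊥ : P))

/-! Removing the bottom of a maximal chain expresses chain counts through atoms: an interval of rank
`k + 1` with nonzero bottom has `B (k + 1) / B k` atoms, and `[⊥, y]` with `y` of rank `k + 1` has
`D (k + 1) / B k`. The Eulerian condition becomes an alternating sum of reciprocals of products of
factorial functions. Comparing it with the same sum for the expected values cancels all terms except
those containing unknown values.

Suppose all intervals with nonzero bottom and rank below `k` are boolean, with `3 ≤ k`. In such an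
interval of rank `k`, sharing a cover is an equivalence relation on atoms whose classes have `k`
elements, and the proper part is a disjoint union of `α` proper parts of boolean lattices; so `B k =
α * k!`. The value `B 3 = 6` starts this, since a rank 3 interval could otherwise be a different
polygon. For even `k` the Euler relation of length `k` gives `α = 1`. For odd `k` that relation is
vacuous, but the one of length `k + 1` rules out `α ≥ 2`. It is available only when `k + 1 < n`, so
`α` stays free exactly at `k = n - 1 = 2m + 1`.

For `D`, the even Euler relation gives `D k = 2 * B (k - 1)`, that is, two atoms under each element
of rank `k`. For odd `k ≥ 5` the atoms pair off, and an even number of at least four contradicts the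
relation of length `k + 1`; `k = 3` is the hypothesis `D 3 = 4`. Hence `P` has two atoms, both below
everything of rank at least two, and above either of them lies a sum of `α` boolean lattices. -/

open Finset

/-! ### Maximal chains of intervals -/

/-- The maximal chains of `[x, y]`, as sets of elements of the ambient poset. -/
def maxChainsIn {P : Type*} [PartialOrder P] (x y : P) : Set (Set P) :=
  {s | s ⊆ Set.Icc x y ∧ IsChain (· ≤ ·) s ∧
    ∀ z ∈ Set.Icc x y, (∀ w ∈ s, z ≤ w ∨ w ≤ z) → z ∈ s}

open Classical in
/-- The atoms of the interval `[x, y]`. -/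
noncomputable def atomsIn {P : Type*} [PartialOrder P] [Fintype P] (x y : P) : Finset P :=
  univ.filter fun a => x ⋖ a ∧ a ≤ y

section Chains

variable {P : Type*} [PartialOrder P]

theorem mem_atomsIn [Fintype P] {x y a : P} : a ∈ atomsIn x y ↔ x ⋖ a ∧ a ≤ y := by
  simp [atomsIn]

theorem flag_image_mem_maxChainsIn {x y : P} (F : Flag (Set.Icc x y)) :
    Subtype.val '' (F : Set (Set.Icc x y)) ∈ maxChainsIn x y := by
  refine ⟨?_, ?_, ?_⟩
  · rintro _ ⟨z, -, rfl⟩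
    exact z.2
  · rintro _ ⟨z, hz, rfl⟩ _ ⟨w, hw, rfl⟩ -
    exact F.le_or_le hz hw
  · intro z hz h
    have hc : IsChain (· ≤ ·) (insert (⟨z, hz⟩ : Set.Icc x y) (F : Set (Set.Icc x y))) := by
      refine F.chain_le.insert fun w hw _ => ?_
      exact h w ⟨w, hw, rfl⟩
    have := F.max_chain' hc (Set.subset_insert _ _)
    refine ⟨⟨z, hz⟩, ?_, rfl⟩
    change (⟨z, hz⟩ : Set.Icc x y) ∈ F.carrier
    rw [this]
    exact Set.mem_insert _ _

/-- Flags of different intervals live in different types; as sets of elements of `P`, a chain of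
`[a, y]` can be extended to one of `[x, y]` by inserting `x`. -/
theorem numMaxChains_eq_card (x y : P) : numMaxChains x y = Nat.card (maxChainsIn x y) := by
  refine Nat.card_congr (Equiv.ofBijective
    (fun F => ⟨Subtype.val '' (F : Set (Set.Icc x y)), flag_image_mem_maxChainsIn F⟩) ⟨?_, ?_⟩)
  · intro F G h
    have h' := congrArg Subtype.val h
    exact SetLike.coe_injective (Set.image_injective.2 Subtype.val_injective h')
  · rintro ⟨s, hs, hc, hm⟩
    refine ⟨⟨Subtype.val ⁻¹' s, ?_, ?_⟩, ?_⟩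
    · intro z hz w hw hne
      exact hc hz hw (fun h => hne (Subtype.ext h))
    · intro t ht hst
      refine Set.Subset.antisymm hst fun z hz => ?_
      refine hm z z.2 fun w hw => ?_
      have hw' : (⟨w, hs hw⟩ : Set.Icc x y) ∈ t := hst hw
      rcases eq_or_ne z ⟨w, hs hw⟩ with h | h
      · left; rw [h]
      · exact ht hz hw' h
    · apply Subtype.ext
      change Subtype.val '' (Subtype.val ⁻¹' s : Set (Set.Icc x y)) = s
      rw [Subtype.image_preimage_coe]
      exact Set.inter_eq_right.2 hs

theorem numMaxChains_self (x : P) : numMaxChains x x = 1 := by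
  rw [numMaxChains_eq_card, Nat.card_eq_one_iff_unique]
  have key : ∀ s ∈ maxChainsIn x x, s = {x} := by
    rintro s ⟨hs, -, hm⟩
    rw [Set.Icc_self] at hs
    refine Set.Subset.antisymm hs (Set.singleton_subset_iff.2 ?_)
    exact hm x ⟨le_rfl, le_rfl⟩ fun w hw => Or.inl (hs hw).ge
  refine ⟨⟨fun s t => Subtype.ext ((key s s.2).trans (key t t.2).symm)⟩, ⟨⟨{x}, ?_, ?_, ?_⟩⟩⟩
  · rw [Set.Icc_self]
  · exact Set.pairwise_singleton _ _
  · intro z hz _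
    rwa [Set.Icc_self] at hz

theorem numMaxChains_pos [Finite P] (x y : P) : 0 < numMaxChains x y := by
  have h : Nonempty (Flag (Set.Icc x y)) := by
    obtain ⟨c, hc, -⟩ := (Set.subsingleton_empty.isChain (r := (· ≤ ·))
      (s := (∅ : Set (Set.Icc x y)))).exists_maxChain
    exact ⟨Flag.ofIsMaxChain c hc⟩
  have : Finite (Flag (Set.Icc x y)) := Finite.of_injective _ SetLike.coe_injective
  exact Nat.card_pos

theorem insert_mem_maxChainsIn {x y a : P} (hxa : x ⋖ a) {s : Set P}
    (hs : s ∈ maxChainsIn a y) (hay : a ≤ y) : insert x s ∈ maxChainsIn x y := by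
  obtain ⟨hs, hc, hm⟩ := hs
  refine ⟨?_, ?_, ?_⟩
  · rintro z (rfl | hz)
    · exact ⟨le_rfl, hxa.le.trans hay⟩
    · exact ⟨hxa.le.trans (hs hz).1, (hs hz).2⟩
  · exact hc.insert fun w hw _ => Or.inl (hxa.le.trans (hs hw).1)
  · intro z hz h
    have ha : a ∈ s := hm a ⟨le_rfl, hay⟩ fun w hw => Or.inl (hs hw).1
    rcases h a (Or.inr ha) with h1 | h1
    · rcases eq_or_ne z x with rfl | hne
      · exact Or.inl rfl
      · rcases eq_or_lt_of_le h1 with rfl | h2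
        · exact Or.inr ha
        · exact absurd h2 (hxa.2 (lt_of_le_of_ne hz.1 hne.symm))
    · exact Or.inr (hm z ⟨h1, hz.2⟩ fun w hw => h w (Or.inr hw))

theorem exists_eq_insert_of_mem_maxChainsIn [Finite P] {x y : P} (hxy : x < y) {t : Set P}
    (ht : t ∈ maxChainsIn x y) :
    ∃ a, x ⋖ a ∧ a ≤ y ∧ ∃ s ∈ maxChainsIn a y, insert x s = t := by
  obtain ⟨hs, hc, hm⟩ := ht
  have hx : x ∈ t := hm x ⟨le_rfl, hxy.le⟩ fun w hw => Or.inl (hs hw).1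
  have hy : y ∈ t := hm y ⟨hxy.le, le_rfl⟩ fun w hw => Or.inr (hs hw).2
  -- In a chain this minimal element is the least one above `x`; maximality of the chain makes it an
  -- atom.
  obtain ⟨a, ha, hmin⟩ := (Set.toFinite (t \ {x})).exists_minimal ⟨y, hy, hxy.ne'⟩
  have hleast : ∀ w ∈ t, w ≠ x → a ≤ w := by
    intro w hw hwx
    rcases eq_or_ne a w with h | h
    · exact h.le
    · rcases hc ha.1 hw h with h | h
      · exact h
      · exact hmin ⟨hw, hwx⟩ h
  have hxa : x < a := lt_of_le_of_ne (hs ha.1).1 (Ne.symm ha.2)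
  refine ⟨a, ⟨hxa, fun c hxc hca => ?_⟩, (hs ha.1).2, t \ {x}, ⟨?_, ?_, ?_⟩, ?_⟩
  · have hct : c ∈ t := by
      refine hm c ⟨hxc.le, hca.le.trans (hs ha.1).2⟩ fun w hw => ?_
      rcases eq_or_ne w x with rfl | h
      · exact Or.inr hxc.le
      · exact Or.inl (hca.le.trans (hleast w hw h))
    exact absurd (hleast c hct hxc.ne') hca.not_ge
  · rintro w ⟨hw, hwx⟩
    exact ⟨hleast w hw hwx, (hs hw).2⟩
  · exact hc.mono Set.sdiff_subset
  · intro z hz h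
    refine ⟨hm z ⟨hxa.le.trans hz.1, hz.2⟩ fun w hw => ?_, (hxa.trans_le hz.1).ne'⟩
    rcases eq_or_ne w x with rfl | hwx
    · exact Or.inr (hxa.le.trans hz.1)
    · exact h w ⟨hw, hwx⟩
  · rw [Set.insert_sdiff_singleton, Set.insert_eq_of_mem hx]

/-- A maximal chain is `x` prepended to a maximal chain of `[a, y]`, where the atom `a` is recovered
as the least element of the remaining chain. -/
theorem numMaxChains_eq_sum [Fintype P] {x y : P} (hxy : x < y) :
    numMaxChains x y = ∑ a ∈ atomsIn x y, numMaxChains a y := by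
  rw [← Finset.sum_coe_sort]
  simp_rw [numMaxChains_eq_card]
  rw [← Nat.card_sigma]
  refine (Nat.card_congr (Equiv.ofBijective
    (fun p : (Σ a : atomsIn x y, maxChainsIn (a : P) y) =>
      (⟨insert x (p.2 : Set P), insert_mem_maxChainsIn (mem_atomsIn.1 p.1.2).1 p.2.2
        (mem_atomsIn.1 p.1.2).2⟩ : maxChainsIn x y)) ⟨?_, ?_⟩)).symm
  · rintro ⟨⟨a, ha⟩, ⟨s, hs⟩⟩ ⟨⟨b, hb⟩, ⟨t, ht⟩⟩ h
    rw [mem_atomsIn] at ha hb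
    have h' : insert x s = insert x t := congrArg Subtype.val h
    have hxs : x ∉ s := fun h => (hs.1 h).1.not_gt ha.1.lt
    have hxt : x ∉ t := fun h => (ht.1 h).1.not_gt hb.1.lt
    have hst : s = t := by
      rw [← Set.insert_sdiff_self_of_notMem hxs, ← Set.insert_sdiff_self_of_notMem hxt, h']
    subst hst
    have has : a ∈ s := hs.2.2 a ⟨le_rfl, ha.2⟩ fun w hw => Or.inl (hs.1 hw).1
    have hbs : b ∈ s := ht.2.2 b ⟨le_rfl, hb.2⟩ fun w hw => Or.inl (ht.1 hw).1
    obtain rfl : a = b := le_antisymm (hs.1 hbs).1 (ht.1 has).1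
    rfl
  · rintro ⟨t, ht⟩
    obtain ⟨a, hxa, hay, s, hs, rfl⟩ := exists_eq_insert_of_mem_maxChainsIn hxy ht
    exact ⟨⟨⟨a, mem_atomsIn.2 ⟨hxa, hay⟩⟩, ⟨s, hs⟩⟩, rfl⟩

end Chains

/-! ### Ranks -/

section Ranks

variable {P : Type*} [PartialOrder P] [GradeMinOrder ℕ P]

theorem grade_of_covBy {x a : P} (h : x ⋖ a) : grade ℕ a = grade ℕ x + 1 :=
  (Nat.covBy_iff_add_one_eq.1 (h.grade ℕ)).symm

theorem grade_le_of_le {x y : P} (h : x ≤ y) : grade ℕ x ≤ grade ℕ y :=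
  grade_mono h

theorem grade_lt_of_lt {x y : P} (h : x < y) : grade ℕ x < grade ℕ y :=
  grade_strictMono h

theorem eq_of_le_of_grade_eq {x y : P} (h : x ≤ y) (hg : grade ℕ x = grade ℕ y) : x = y := by
  by_contra hne
  exact (grade_lt_of_lt (lt_of_le_of_ne h hne)).ne hg

theorem covBy_of_le_of_grade {x y : P} (h : x ≤ y) (hg : grade ℕ y = grade ℕ x + 1) : x ⋖ y := by
  refine ⟨lt_of_le_of_ne h ?_, fun c hxc hcy => ?_⟩
  · rintro rfl
    omega
  · have h1 := grade_lt_of_lt hxc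
    have h2 := grade_lt_of_lt hcy
    omega

variable [Fintype P]

open Classical in
/-- The elements of rank `i` of the interval `[x, y]`. -/
noncomputable def levelIn (x y : P) (i : ℕ) : Finset P :=
  univ.filter fun z => x ≤ z ∧ z ≤ y ∧ grade ℕ z = grade ℕ x + i

theorem mem_levelIn {x y z : P} {i : ℕ} :
    z ∈ levelIn x y i ↔ x ≤ z ∧ z ≤ y ∧ grade ℕ z = grade ℕ x + i := by
  simp [levelIn]

theorem levelIn_one {x y : P} : levelIn x y 1 = atomsIn x y := by
  ext a
  rw [mem_levelIn, mem_atomsIn]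
  constructor
  · rintro ⟨h1, h2, h3⟩
    exact ⟨covBy_of_le_of_grade h1 h3, h2⟩
  · rintro ⟨h1, h2⟩
    exact ⟨h1.le, h2, grade_of_covBy h1⟩

/-- Every maximal chain of an interval meets each rank exactly once. -/
theorem sum_levelIn_mul {x y : P} (hxy : x ≤ y) {i : ℕ} (hi : grade ℕ x + i ≤ grade ℕ y) :
    ∑ z ∈ levelIn x y i, numMaxChains x z * numMaxChains z y = numMaxChains x y := by
  induction i generalizing x with
  | zero =>
    have : levelIn x y 0 = {x} := by
      ext z
      rw [mem_levelIn, Finset.mem_singleton]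
      constructor
      · rintro ⟨h1, -, h3⟩
        exact (eq_of_le_of_grade_eq h1 (by omega)).symm
      · rintro rfl
        exact ⟨le_rfl, hxy, rfl⟩
    rw [this, Finset.sum_singleton, numMaxChains_self, one_mul]
  | succ i ih =>
    have hlt : x < y := lt_of_le_of_ne hxy (by rintro rfl; omega)
    rw [numMaxChains_eq_sum hlt]
    have h1 : ∀ a ∈ atomsIn x y, numMaxChains a y =
        ∑ z ∈ levelIn a y i, numMaxChains a z * numMaxChains z y := by
      intro a ha
      rw [mem_atomsIn] at ha
      exact (ih ha.2 (by rw [grade_of_covBy ha.1]; omega)).symm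
    rw [Finset.sum_congr rfl h1]
    have h2 : ∀ z ∈ levelIn x y (i + 1), numMaxChains x z * numMaxChains z y =
        ∑ a ∈ atomsIn x z, numMaxChains a z * numMaxChains z y := by
      intro z hz
      rw [mem_levelIn] at hz
      have hxz : x < z := lt_of_le_of_ne hz.1 (by rintro rfl; omega)
      rw [numMaxChains_eq_sum hxz, Finset.sum_mul]
    rw [Finset.sum_congr rfl h2]
    -- Both sides now sum over pairs of an atom `a` and an element `z ≥ a` at height `i + 1` above
    -- `x`.
    refine Finset.sum_comm' fun z a => ?_
    simp only [mem_levelIn, mem_atomsIn]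
    constructor
    · rintro ⟨⟨-, h2, h3⟩, h4, h5⟩
      have := grade_of_covBy h4
      exact ⟨⟨h5, h2, by omega⟩, h4, h5.trans h2⟩
    · rintro ⟨⟨h5, h2, h3⟩, h4, -⟩
      have := grade_of_covBy h4
      exact ⟨⟨h4.le.trans h5, h2, by omega⟩, h4, h5⟩

theorem levelIn_nonempty {x y : P} (hxy : x ≤ y) {i : ℕ} (hi : grade ℕ x + i ≤ grade ℕ y) :
    (levelIn x y i).Nonempty := by
  by_contra h
  rw [Finset.not_nonempty_iff_eq_empty] at h
  have := sum_levelIn_mul hxy hi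
  rw [h, Finset.sum_empty] at this
  exact (numMaxChains_pos x y).ne this

theorem atomsIn_nonempty {x y : P} (hxy : x < y) : (atomsIn x y).Nonempty := by
  rw [← levelIn_one]
  exact levelIn_nonempty hxy.le (grade_lt_of_lt hxy)

theorem card_levelIn_mul {x y : P} (hxy : x ≤ y) {i : ℕ} (hi : grade ℕ x + i ≤ grade ℕ y) {w : ℕ}
    (hw : ∀ z ∈ levelIn x y i, numMaxChains x z * numMaxChains z y = w) :
    #(levelIn x y i) * w = numMaxChains x y := by
  rw [← sum_levelIn_mul hxy hi, Finset.sum_congr rfl hw, Finset.sum_const, smul_eq_mul]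

/-- The Euler relation of an Eulerian poset in which the number of maximal chains of `[x, y]`
through `z` only depends on the rank of `z`. -/
theorem IsEulerianPoset.sum_eq_zero (hE : IsEulerianPoset P) {x y : P} (hxy : x < y) {k : ℕ}
    (hk : grade ℕ y = grade ℕ x + k) (w : ℕ → ℕ)
    (hw : ∀ z, x ≤ z → z ≤ y →
      numMaxChains x z * numMaxChains z y = w (grade ℕ z - grade ℕ x)) :
    ∑ i ∈ range (k + 1), (-1 : ℚ) ^ i / w i = 0 := by
  classical
  -- Level `i` has `numMaxChains x y / w i` elements. The factor `(-1) ^ grade ℕ x` converts ranks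
  -- in `P` to ranks in the interval.
  have hN : ∀ i ∈ range (k + 1), (-1 : ℚ) ^ i / w i =
      (∑ z ∈ levelIn x y i, (-1 : ℚ) ^ (grade ℕ z)) * ((-1) ^ grade ℕ x / numMaxChains x y) := by
    intro i hi
    rw [Finset.mem_range] at hi
    have hi' : grade ℕ x + i ≤ grade ℕ y := by omega
    have h1 := card_levelIn_mul hxy.le hi' (w := w i) (by
      intro z hz
      rw [mem_levelIn] at hz
      rw [hw z hz.1 hz.2.1]
      congr 1
      omega)
    have h2 : ∑ z ∈ levelIn x y i, (-1 : ℚ) ^ (grade ℕ z) =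
        #(levelIn x y i) * (-1) ^ (grade ℕ x + i) := by
      rw [Finset.sum_congr rfl (fun z hz => by rw [(mem_levelIn.1 hz).2.2]), Finset.sum_const,
        nsmul_eq_mul]
    have hf := numMaxChains_pos x y
    rw [h2, ← h1]
    rw [← h1] at hf
    have hw0 : (w i : ℚ) ≠ 0 := by
      have := (Nat.pos_of_mul_pos_left hf).ne'
      exact_mod_cast this
    have hc0 : (#(levelIn x y i) : ℚ) ≠ 0 := by
      have := (Nat.pos_of_mul_pos_right hf).ne'
      exact_mod_cast this
    have hs : ((-1 : ℚ) ^ grade ℕ x) * (-1) ^ grade ℕ x = 1 := by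
      rw [← mul_pow]; norm_num
    push_cast
    rw [pow_add]
    field_simp
    linear_combination -hs
  rw [Finset.sum_congr rfl hN, ← Finset.sum_mul]
  have hsum : ∑ i ∈ range (k + 1), ∑ z ∈ levelIn x y i, (-1 : ℚ) ^ (grade ℕ z) =
      ∑ z ∈ univ.filter (fun z => z ∈ Set.Icc x y), (-1 : ℚ) ^ (grade ℕ z) := by
    rw [← Finset.sum_fiberwise_of_maps_to (s := univ.filter (fun z => z ∈ Set.Icc x y))
      (t := range (k + 1)) (g := fun z => grade ℕ z - grade ℕ x)]
    · refine Finset.sum_congr rfl fun i _ => Finset.sum_congr ?_ fun _ _ => rfl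
      ext z
      simp only [mem_levelIn, Finset.mem_filter, Finset.mem_univ, true_and, Set.mem_Icc]
      constructor
      · rintro ⟨h1, h2, h3⟩
        exact ⟨⟨h1, h2⟩, by omega⟩
      · rintro ⟨⟨h1, h2⟩, h3⟩
        have := grade_le_of_le h1
        exact ⟨h1, h2, by omega⟩
    · intro z hz
      simp only [Finset.mem_filter, Finset.mem_univ, true_and, Set.mem_Icc] at hz
      have := grade_le_of_le hz.2
      simp only [Finset.mem_range]
      omega
  have hzero : ∑ z ∈ univ.filter (fun z => z ∈ Set.Icc x y), (-1 : ℚ) ^ (grade ℕ z) = 0 := by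
    rw [← Finset.sum_filter_add_sum_filter_not _ (fun z => Even (grade ℕ z))]
    have he := hE x y hxy
    have e1 : {z : P | z ∈ Set.Icc x y ∧ Even (grade ℕ z)} =
        ↑((univ.filter (fun z => z ∈ Set.Icc x y)).filter (fun z => Even (grade ℕ z))) := by
      ext z; simp
    have e2 : {z : P | z ∈ Set.Icc x y ∧ Odd (grade ℕ z)} =
        ↑((univ.filter (fun z => z ∈ Set.Icc x y)).filter (fun z => ¬ Even (grade ℕ z))) := by
      ext z; simp
    rw [e1, e2, Set.ncard_coe_finset, Set.ncard_coe_finset] at he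
    rw [Finset.sum_congr rfl (fun z hz => (Finset.mem_filter.1 hz).2.neg_one_pow),
      Finset.sum_congr (g := fun _ => (-1 : ℚ)) rfl (fun z hz =>
        (Nat.not_even_iff_odd.1 (Finset.mem_filter.1 hz).2).neg_one_pow)]
    simp only [Finset.sum_const, nsmul_eq_mul, he]
    ring
  rw [hsum, hzero, zero_mul]

end Ranks

/-! ### Boolean intervals and sums of boolean lattices -/

/-- The interval `[x, y]` is a boolean lattice: sending an element to the set of atoms of `[x, y]`
below it identifies `[x, y]` with the lattice of all sets of atoms. -/
structure IsBooleanInterval {P : Type*} [PartialOrder P] [Fintype P] (x y : P) : Prop where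
  le_of_subset : ∀ z w, x ≤ z → z ≤ y → x ≤ w → w ≤ y → atomsIn x z ⊆ atomsIn x w → z ≤ w
  exists_eq : ∀ S ⊆ atomsIn x y, ∃ z, x ≤ z ∧ z ≤ y ∧ atomsIn x z = S

/-- The interval `[x, y]` has rank `k` and its proper lower intervals, and its upper intervals
starting in an atom, are boolean lattices. -/
structure IsLocallyBoolean {P : Type*} [PartialOrder P] [GradeMinOrder ℕ P] [Fintype P]
    (x y : P) (k : ℕ) : Prop where
  le : x ≤ y
  rank : grade ℕ y = grade ℕ x + k
  lower : ∀ z, x ≤ z → z < y → IsBooleanInterval x z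
  card_lower : ∀ z, x ≤ z → z < y → #(atomsIn x z) = grade ℕ z - grade ℕ x
  upper : ∀ a ∈ atomsIn x y, IsBooleanInterval a y
  card_upper : ∀ a ∈ atomsIn x y, #(atomsIn a y) = k - 1

/-- Two elements are equal or have a common cover below `y`. -/
def HaveCommonCover {P : Type*} [PartialOrder P] (y a b : P) : Prop :=
  a = b ∨ ∃ p, a ⋖ p ∧ b ⋖ p ∧ p ≤ y

/-- The proper part of `[x, y]` is a disjoint union of `α` copies of the proper part of the
boolean lattice of rank `k`; the atoms of the `i`-th copy are the elements `e i s`. -/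
structure IsBooleanSum {P : Type*} [PartialOrder P] [Fintype P] [DecidableEq P] (x y : P)
    {α k : ℕ} (e : Fin α → Fin k → P) : Prop where
  inj : ∀ i s j t, e i s = e j t → i = j ∧ s = t
  mem_iff : ∀ a, a ∈ atomsIn x y ↔ ∃ i s, e i s = a
  exists_index : ∀ z, x < z → z < y → ∃ i, ∀ a ∈ atomsIn x z, ∃ s, e i s = a
  exists_eq : ∀ i (S : Finset (Fin k)), S.Nonempty → S ≠ univ →
    ∃ z, x < z ∧ z < y ∧ atomsIn x z = S.image (e i)
  le_of_subset : ∀ z w, x < z → z < y → x < w → w < y → atomsIn x z ⊆ atomsIn x w → z ≤ w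
  card_lt : ∀ z, x < z → z < y → #(atomsIn x z) < k

section Atoms

variable {P : Type*} [PartialOrder P] [Fintype P]

theorem atomsIn_mono {x z w : P} (h : z ≤ w) : atomsIn x z ⊆ atomsIn x w := fun a ha => by
  rw [mem_atomsIn] at ha ⊢
  exact ⟨ha.1, ha.2.trans h⟩

theorem atomsIn_self (x : P) : atomsIn x x = ∅ := by
  ext a
  simp only [mem_atomsIn, Finset.notMem_empty, iff_false]
  rintro ⟨h, h'⟩
  exact h.lt.not_ge h'

theorem atomsIn_of_covBy {x a : P} (h : x ⋖ a) : atomsIn x a = {a} := by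
  ext b
  rw [mem_atomsIn, Finset.mem_singleton]
  constructor
  · rintro ⟨h1, h2⟩
    by_contra hne
    exact h.2 h1.lt (lt_of_le_of_ne h2 hne)
  · rintro rfl
    exact ⟨h, le_rfl⟩

omit [Fintype P] in
theorem HaveCommonCover.symm {y a b : P} (h : HaveCommonCover y a b) : HaveCommonCover y b a := by
  rcases h with rfl | ⟨p, h1, h2, h3⟩
  · exact Or.inl rfl
  · exact Or.inr ⟨p, h2, h1, h3⟩

theorem IsBooleanInterval.eq_of_atomsIn_eq {x y z w : P} (h : IsBooleanInterval x y)
    (h1 : x ≤ z) (h2 : z ≤ y) (h3 : x ≤ w) (h4 : w ≤ y) (he : atomsIn x z = atomsIn x w) :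
    z = w :=
  le_antisymm (h.le_of_subset z w h1 h2 h3 h4 he.le) (h.le_of_subset w z h3 h4 h1 h2 he.ge)

end Atoms

/-! ### Splitting a locally boolean interval into boolean summands -/

section LocallyBoolean

variable {P : Type*} [PartialOrder P] [GradeMinOrder ℕ P] [Fintype P]
  {x y : P} {k : ℕ}

namespace IsLocallyBoolean

/-- Since `k ≥ 3`, the rank 2 interval `[x, p]` is proper, hence has two atoms: a cover of `a`
determines a partner of `a`. -/
theorem exists_pair (h : IsLocallyBoolean x y k) (hk : 3 ≤ k) [DecidableEq P] {a p : P}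
    (ha : a ∈ atomsIn x y) (hp : p ∈ atomsIn a y) :
    ∃ b, b ≠ a ∧ b ∈ atomsIn x y ∧ b ⋖ p ∧ atomsIn x p = {a, b} := by
  have ha' := mem_atomsIn.1 ha
  have hp' := mem_atomsIn.1 hp
  have g1 := grade_of_covBy ha'.1
  have g2 := grade_of_covBy hp'.1
  have g3 := h.rank
  have hxp : x ≤ p := ha'.1.le.trans hp'.1.le
  have hpy : p < y := lt_of_le_of_ne hp'.2 (by rintro rfl; omega)
  have hc := h.card_lower p hxp hpy
  have hap : a ∈ atomsIn x p := mem_atomsIn.2 ⟨ha'.1, hp'.1.le⟩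
  have hc1 : #((atomsIn x p).erase a) = 1 := by
    rw [Finset.card_erase_of_mem hap]; omega
  obtain ⟨b, hb⟩ := Finset.card_eq_one.1 hc1
  have hb' : b ∈ (atomsIn x p).erase a := by rw [hb]; exact Finset.mem_singleton_self b
  have hbp := mem_atomsIn.1 (Finset.mem_of_mem_erase hb')
  have g4 := grade_of_covBy hbp.1
  refine ⟨b, Finset.ne_of_mem_erase hb', mem_atomsIn.2 ⟨hbp.1, hbp.2.trans hp'.2⟩,
    covBy_of_le_of_grade hbp.2 (by omega), ?_⟩
  rw [← Finset.insert_erase hap, hb]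

theorem atomsIn_eq_pair (h : IsLocallyBoolean x y k) (hk : 3 ≤ k) [DecidableEq P] {a b p : P}
    (ha : x ⋖ a) (hb : x ⋖ b) (hab : b ≠ a) (hap : a ⋖ p) (hbp : b ≤ p) (hp : p ≤ y) :
    atomsIn x p = {a, b} := by
  obtain ⟨c, -, -, -, hc⟩ := h.exists_pair hk (mem_atomsIn.2 ⟨ha, hap.le.trans hp⟩)
    (mem_atomsIn.2 ⟨hap, hp⟩)
  have : b ∈ atomsIn x p := mem_atomsIn.2 ⟨hb, hbp⟩
  rw [hc, Finset.mem_insert, Finset.mem_singleton] at this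
  rw [hc, this.resolve_left hab]

theorem lt_of_atomsIn_eq (h : IsLocallyBoolean x y k) {a r : P} (ha : a ∈ atomsIn x y)
    (hry : r ≤ y) (hc : #(atomsIn a r) < k - 1) : r < y :=
  lt_of_le_of_ne hry (by rintro rfl; exact hc.ne (h.card_upper a ha))

/-- Two atoms have at most one common cover. -/
theorem commonCover_unique (h : IsLocallyBoolean x y k) (hk : 3 ≤ k)
    (h3 : k = 3 → #(atomsIn x y) = 3) {a b p q : P} (ha : x ⋖ a) (hb : x ⋖ b) (hab : b ≠ a)
    (hap : a ⋖ p) (hbp : b ⋖ p) (hp : p ≤ y) (haq : a ⋖ q) (hbq : b ⋖ q) (hq : q ≤ y) : p = q := by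
  classical
  by_contra hpq
  have hay : a ∈ atomsIn x y := mem_atomsIn.2 ⟨ha, hap.le.trans hp⟩
  have hby : b ∈ atomsIn x y := mem_atomsIn.2 ⟨hb, hbp.le.trans hp⟩
  have hpm : p ∈ atomsIn a y := mem_atomsIn.2 ⟨hap, hp⟩
  have hqm : q ∈ atomsIn a y := mem_atomsIn.2 ⟨haq, hq⟩
  have ep := h.atomsIn_eq_pair hk ha hb hab hap hbp.le hp
  have eq := h.atomsIn_eq_pair hk ha hb hab haq hbq.le hq
  rcases hk.eq_or_lt with hk3 | hk4
  -- For `k = 3`, the elements `p`, `q` exhaust the covers of `a` and of `b`. A cover of the third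
  -- atom also lies above `a` or `b`, so it is `p` or `q`, whose atoms are only `a` and `b`.
  · have hcard := h3 hk3.symm
    have ha2 := h.card_upper a hay
    have hb2 := h.card_upper b hby
    have hA : atomsIn a y = {p, q} := by
      refine (Finset.eq_of_subset_of_card_le ?_ ?_).symm
      · intro z hz
        rw [Finset.mem_insert, Finset.mem_singleton] at hz
        rcases hz with rfl | rfl <;> assumption
      · rw [ha2, Finset.card_pair hpq]; omega
    have hB : atomsIn b y = {p, q} := by
      refine (Finset.eq_of_subset_of_card_le ?_ ?_).symm
      · intro z hz
        rw [Finset.mem_insert, Finset.mem_singleton] at hz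
        rcases hz with rfl | rfl
        · exact mem_atomsIn.2 ⟨hbp, hp⟩
        · exact mem_atomsIn.2 ⟨hbq, hq⟩
      · rw [hb2, Finset.card_pair hpq]; omega
    obtain ⟨c, hc, hcab⟩ : ∃ c ∈ atomsIn x y, c ∉ ({a, b} : Finset P) := by
      by_contra! hcon
      have := Finset.card_le_card (show atomsIn x y ⊆ {a, b} from hcon)
      rw [hcard, Finset.card_pair hab.symm] at this
      omega
    have hcy := mem_atomsIn.1 hc
    have g1 := grade_of_covBy hcy.1
    have g2 := h.rank
    obtain ⟨r, hr⟩ := atomsIn_nonempty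
      (lt_of_le_of_ne hcy.2 (by rintro rfl; omega))
    obtain ⟨d, hdc, hdy, hdr, hd⟩ := h.exists_pair hk hc hr
    have hr' := mem_atomsIn.1 hr
    have hrpq : r ∈ ({p, q} : Finset P) := by
      have hT : atomsIn x y = {a, b, c} := by
        refine (Finset.eq_of_subset_of_card_le ?_ ?_).symm
        · intro z hz
          simp only [Finset.mem_insert, Finset.mem_singleton] at hz
          rcases hz with rfl | rfl | rfl <;> assumption
        · rw [hcard, Finset.card_eq_three.2 ⟨a, b, c, hab.symm, ?_, ?_, rfl⟩]
          · rintro rfl; simp at hcab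
          · rintro rfl; simp at hcab
      rw [hT] at hdy
      simp only [Finset.mem_insert, Finset.mem_singleton] at hdy
      rcases hdy with rfl | rfl | rfl
      · rw [← hA]; exact mem_atomsIn.2 ⟨hdr, hr'.2⟩
      · rw [← hB]; exact mem_atomsIn.2 ⟨hdr, hr'.2⟩
      · exact absurd rfl hdc
    have hcr : c ∈ atomsIn x r := mem_atomsIn.2 ⟨hcy.1, hr'.1.le⟩
    rw [Finset.mem_insert, Finset.mem_singleton] at hrpq
    rcases hrpq with rfl | rfl
    · rw [ep] at hcr; exact hcab hcr
    · rw [eq] at hcr; exact hcab hcr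
  -- For `k ≥ 4`, the join `r` of `p` and `q` in `[a, y]` is proper, so `[x, r]` is boolean and its
  -- elements `p`, `q` with equal atom sets coincide.
  · obtain ⟨r, har, hry, hr⟩ := (h.upper a hay).exists_eq {p, q} (by
      intro z hz
      rw [Finset.mem_insert, Finset.mem_singleton] at hz
      rcases hz with rfl | rfl <;> assumption)
    have hlt : r < y := h.lt_of_atomsIn_eq hay hry (by rw [hr, Finset.card_pair hpq]; omega)
    have hpr : p ≤ r := (mem_atomsIn.1 (show p ∈ atomsIn a r by rw [hr]; simp)).2
    have hqr : q ≤ r := (mem_atomsIn.1 (show q ∈ atomsIn a r by rw [hr]; simp)).2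
    exact hpq ((h.lower r (ha.le.trans har) hlt).eq_of_atomsIn_eq (ha.le.trans hap.le) hpr
      (ha.le.trans haq.le) hqr (ep.trans eq.symm))

open Classical in
-- The other members of the class of `a` correspond bijectively to the `k - 1` covers of `a`, each
-- cover giving the second atom below it.
theorem card_haveCommonCover (h : IsLocallyBoolean x y k) (hk : 3 ≤ k)
    (h3 : k = 3 → #(atomsIn x y) = 3) {a : P} (ha : a ∈ atomsIn x y) :
    #((atomsIn x y).filter (HaveCommonCover y a)) = k := by
  have ha' := mem_atomsIn.1 ha
  have hmem : a ∈ (atomsIn x y).filter (HaveCommonCover y a) :=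
    Finset.mem_filter.2 ⟨ha, Or.inl rfl⟩
  have key : #(atomsIn a y) = #(((atomsIn x y).filter (HaveCommonCover y a)).erase a) := by
    refine Finset.card_bij (fun p hp => (h.exists_pair hk ha hp).choose) ?_ ?_ ?_
    · intro p hp
      obtain ⟨h1, h2, h3, -⟩ := (h.exists_pair hk ha hp).choose_spec
      have hp' := mem_atomsIn.1 hp
      exact Finset.mem_erase.2 ⟨h1, Finset.mem_filter.2 ⟨h2, Or.inr ⟨p, hp'.1, h3, hp'.2⟩⟩⟩
    · intro p hp q hq hpq
      obtain ⟨h1, h2, h4, -⟩ := (h.exists_pair hk ha hp).choose_spec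
      obtain ⟨-, -, h5, -⟩ := (h.exists_pair hk ha hq).choose_spec
      have hp' := mem_atomsIn.1 hp
      have hq' := mem_atomsIn.1 hq
      rw [← hpq] at h5
      exact h.commonCover_unique hk h3 ha'.1 (mem_atomsIn.1 h2).1 h1 hp'.1 h4 hp'.2 hq'.1 h5 hq'.2
    · intro b hb
      rw [Finset.mem_erase, Finset.mem_filter] at hb
      obtain ⟨hba, hby, hcc⟩ := hb
      obtain ⟨p, h1, h2, h4⟩ := hcc.resolve_left (Ne.symm hba)
      have hp : p ∈ atomsIn a y := mem_atomsIn.2 ⟨h1, h4⟩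
      refine ⟨p, hp, ?_⟩
      obtain ⟨-, -, -, h5⟩ := (h.exists_pair hk ha hp).choose_spec
      have hbp : b ∈ atomsIn x p := mem_atomsIn.2 ⟨(mem_atomsIn.1 hby).1, h2.le⟩
      rw [h5, Finset.mem_insert, Finset.mem_singleton] at hbp
      exact (hbp.resolve_left hba).symm
  rw [← Finset.card_erase_add_one hmem, ← key, h.card_upper a ha]
  omega

/-- Two atoms below a proper element have a common cover below that element. -/
theorem exists_cover_le (h : IsLocallyBoolean x y k) {a b z : P} (hz : z < y)
    (ha : a ∈ atomsIn x z) (hb : b ∈ atomsIn x z) (hab : b ≠ a) :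
    ∃ p, p ≤ z ∧ a ⋖ p ∧ b ⋖ p := by
  classical
  have ha' := mem_atomsIn.1 ha
  have hb' := mem_atomsIn.1 hb
  have hxz : x ≤ z := ha'.1.le.trans ha'.2
  obtain ⟨p, h1, h2, h3⟩ := (h.lower z hxz hz).exists_eq {a, b} (by
    intro c hc
    rw [Finset.mem_insert, Finset.mem_singleton] at hc
    rcases hc with rfl | rfl <;> assumption)
  have hc := h.card_lower p h1 (h2.trans_lt hz)
  rw [h3, Finset.card_pair hab.symm] at hc
  have hap : a ≤ p := (mem_atomsIn.1 (show a ∈ atomsIn x p by rw [h3]; simp)).2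
  have hbp : b ≤ p := (mem_atomsIn.1 (show b ∈ atomsIn x p by rw [h3]; simp)).2
  have g1 := grade_of_covBy ha'.1
  have g2 := grade_of_covBy hb'.1
  exact ⟨p, h2, covBy_of_le_of_grade hap (by omega), covBy_of_le_of_grade hbp (by omega)⟩

theorem haveCommonCover_of_mem (h : IsLocallyBoolean x y k) {a b z : P} (hz : z < y)
    (ha : a ∈ atomsIn x z) (hb : b ∈ atomsIn x z) : HaveCommonCover y a b := by
  rcases eq_or_ne b a with rfl | hab
  · exact Or.inl rfl
  · obtain ⟨p, h1, h2, h3⟩ := h.exists_cover_le hz ha hb hab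
    exact Or.inr ⟨p, h2, h3, h1.trans hz.le⟩

/-- For `k = 3` the class of `a` already contains all three atoms. For `k ≥ 4` the join, above `b`,
of the two given covers is proper, and two atoms below a proper element have a common cover. -/
theorem haveCommonCover_trans (h : IsLocallyBoolean x y k) (hk : 3 ≤ k)
    (h3 : k = 3 → #(atomsIn x y) = 3) {a b c : P} (ha : a ∈ atomsIn x y) (hb : b ∈ atomsIn x y)
    (hc : c ∈ atomsIn x y) (hab : HaveCommonCover y a b) (hbc : HaveCommonCover y b c) :
    HaveCommonCover y a c := by
  classical
  rcases hk.eq_or_lt with hk3 | hk4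
  · have h1 := h.card_haveCommonCover hk h3 ha
    have h2 := Finset.eq_of_subset_of_card_le
      (Finset.filter_subset (HaveCommonCover y a) (atomsIn x y)) (by rw [h1, h3 hk3.symm]; omega)
    rw [← h2] at hc
    exact (Finset.mem_filter.1 hc).2
  · rcases hab with rfl | ⟨p, hap, hbp, hp⟩
    · exact hbc
    rcases hbc with rfl | ⟨q, hbq, hcq, hq⟩
    · exact Or.inr ⟨p, hap, hbp, hp⟩
    obtain ⟨r, hbr, hry, hr⟩ := (h.upper b hb).exists_eq {p, q} (by
      intro z hz
      rw [Finset.mem_insert, Finset.mem_singleton] at hz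
      rcases hz with rfl | rfl
      · exact mem_atomsIn.2 ⟨hbp, hp⟩
      · exact mem_atomsIn.2 ⟨hbq, hq⟩)
    have hlt : r < y := h.lt_of_atomsIn_eq hb hry (by
      have := Finset.card_le_two (a := p) (b := q)
      rw [hr]; omega)
    have hpr : p ≤ r := (mem_atomsIn.1 (show p ∈ atomsIn b r by rw [hr]; simp)).2
    have hqr : q ≤ r := (mem_atomsIn.1 (show q ∈ atomsIn b r by rw [hr]; simp)).2
    exact h.haveCommonCover_of_mem hlt (mem_atomsIn.2 ⟨(mem_atomsIn.1 ha).1, hap.le.trans hpr⟩)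
      (mem_atomsIn.2 ⟨(mem_atomsIn.1 hc).1, hcq.le.trans hqr⟩)

/-- For an atom `a ≤ z` the comparison takes place in the boolean interval `[a, y]`. A cover of `a`
below `z` is the unique common cover of `a` and a partner `b`; both atoms lie below `w`, hence so
does this cover. -/
theorem le_of_atomsIn_subset (h : IsLocallyBoolean x y k) (hk : 3 ≤ k)
    (h3 : k = 3 → #(atomsIn x y) = 3) {z w : P} (hxz : x < z) (hzy : z < y) (hwy : w < y)
    (hsub : atomsIn x z ⊆ atomsIn x w) : z ≤ w := by
  classical
  obtain ⟨a, ha⟩ := atomsIn_nonempty hxz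
  have ha' := mem_atomsIn.1 ha
  have haw := mem_atomsIn.1 (hsub ha)
  have hay : a ∈ atomsIn x y := atomsIn_mono hzy.le ha
  refine (h.upper a hay).le_of_subset z w ha'.2 hzy.le haw.2 hwy.le fun p hp => ?_
  have hp' := mem_atomsIn.1 hp
  obtain ⟨b, hba, hby, hbp, -⟩ := h.exists_pair hk hay (atomsIn_mono hzy.le hp)
  have hby' := mem_atomsIn.1 hby
  have hbz : b ∈ atomsIn x z := mem_atomsIn.2 ⟨hby'.1, hbp.le.trans hp'.2⟩
  obtain ⟨q, hqw, haq, hbq⟩ := h.exists_cover_le hwy (hsub ha) (hsub hbz) hba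
  obtain rfl := h.commonCover_unique hk h3 ha'.1 hby'.1 hba hp'.1 hbp (hp'.2.trans hzy.le)
    haq hbq (hqw.trans hwy.le)
  exact mem_atomsIn.2 ⟨haq, hqw⟩

/-- The element is built in the boolean interval `[a, y]` as the join of the covers of `a` whose
atoms all belong to `S`. The atom `b` outside `S` in the same class keeps it below `y`. -/
theorem exists_atomsIn_eq (h : IsLocallyBoolean x y k) (hk : 3 ≤ k) {a b : P} {S : Finset P}
    (haS : a ∈ S) (hS : ∀ c ∈ S, c ∈ atomsIn x y ∧ HaveCommonCover y a c)
    (hb : b ∈ atomsIn x y) (hab : HaveCommonCover y a b) (hbS : b ∉ S) :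
    ∃ z, x < z ∧ z < y ∧ atomsIn x z = S := by
  classical
  have hay := (hS a haS).1
  have ha' := mem_atomsIn.1 hay
  obtain ⟨z, haz, hzy, hz⟩ := (h.upper a hay).exists_eq
    ((atomsIn a y).filter fun p => atomsIn x p ⊆ S) (Finset.filter_subset _ _)
  have hzlt : z < y := by
    refine lt_of_le_of_ne hzy ?_
    rintro rfl
    obtain ⟨p, h1, h2, h3⟩ := hab.resolve_left (by rintro rfl; exact hbS haS)
    have hp : p ∈ atomsIn a z := mem_atomsIn.2 ⟨h1, h3⟩
    rw [hz, Finset.mem_filter] at hp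
    exact hbS (hp.2 (mem_atomsIn.2 ⟨(mem_atomsIn.1 hb).1, h2.le⟩))
  have haz' : a ∈ atomsIn x z := mem_atomsIn.2 ⟨ha'.1, haz⟩
  refine ⟨z, ha'.1.lt.trans_le haz, hzlt, ?_⟩
  ext c
  constructor
  · intro hc
    rcases eq_or_ne c a with rfl | hca
    · exact haS
    obtain ⟨p, hpz, hap, hcp⟩ := h.exists_cover_le hzlt haz' hc hca
    have hp : p ∈ atomsIn a z := mem_atomsIn.2 ⟨hap, hpz⟩
    rw [hz, Finset.mem_filter] at hp
    exact hp.2 (mem_atomsIn.2 ⟨(mem_atomsIn.1 hc).1, hcp.le⟩)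
  · intro hc
    rcases eq_or_ne c a with rfl | hca
    · exact haz'
    obtain ⟨hcy, hcc⟩ := hS c hc
    obtain ⟨p, hap, hcp, hp⟩ := hcc.resolve_left (Ne.symm hca)
    have hcx := (mem_atomsIn.1 hcy).1
    have hpz : p ∈ atomsIn a z := by
      rw [hz, Finset.mem_filter]
      refine ⟨mem_atomsIn.2 ⟨hap, hp⟩, ?_⟩
      rw [h.atomsIn_eq_pair hk ha'.1 hcx hca hap hcp.le hp]
      intro d hd
      rw [Finset.mem_insert, Finset.mem_singleton] at hd
      rcases hd with rfl | rfl <;> assumption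
    exact mem_atomsIn.2 ⟨hcx, hcp.le.trans (mem_atomsIn.1 hpz).2⟩

/-- A locally boolean interval of rank at least three is a sum of boolean lattices. -/
theorem exists_isBooleanSum [DecidableEq P] (h : IsLocallyBoolean x y k) (hk : 3 ≤ k)
    (h3 : k = 3 → #(atomsIn x y) = 3) :
    ∃ (α : ℕ) (e : Fin α → Fin k → P), IsBooleanSum x y e := by
  classical
  -- The classes index the summands; each has `k` elements, labelled by `Fin k`.
  let r : Setoid (atomsIn x y) :=
    { r := fun a b => HaveCommonCover y (a : P) b
      iseqv := ⟨fun a => Or.inl rfl, fun h => h.symm,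
        fun {a b c} hab hbc => h.haveCommonCover_trans hk h3 a.2 b.2 c.2 hab hbc⟩ }
  have hr : ∀ a b : atomsIn x y, (⟦a⟧ : Quotient r) = ⟦b⟧ ↔ HaveCommonCover y (a : P) b :=
    fun a b => Quotient.eq
  have hcard : ∀ c : Quotient r, Nat.card {a : atomsIn x y // (⟦a⟧ : Quotient r) = c} = k := by
    intro c
    induction c using Quotient.inductionOn with
    | _ a =>
      rw [← h.card_haveCommonCover hk h3 a.2, ← Fintype.card_coe, ← Nat.card_eq_fintype_card]
      refine Nat.card_congr ⟨fun b => ⟨b.1.1, Finset.mem_filter.2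
          ⟨b.1.2, ((hr b.1 a).1 b.2).symm⟩⟩,
        fun b => ⟨⟨b.1, (Finset.mem_filter.1 b.2).1⟩,
          (hr _ a).2 (Finset.mem_filter.1 b.2).2.symm⟩, fun b => rfl, fun b => rfl⟩
  let q : Quotient r ≃ Fin (Nat.card (Quotient r)) := Finite.equivFin _
  let f : ∀ c : Quotient r, {a : atomsIn x y // (⟦a⟧ : Quotient r) = c} ≃ Fin k :=
    fun c => Finite.equivFinOfCardEq (hcard c)
  have hcls : ∀ i s, (⟦((f (q.symm i)).symm s).1⟧ : Quotient r) = q.symm i :=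
    fun i s => ((f (q.symm i)).symm s).2
  have hmem : ∀ (a : atomsIn x y) i, (⟦a⟧ : Quotient r) = q.symm i →
      ∃ s, ((f (q.symm i)).symm s).1 = a := by
    intro a i hi
    exact ⟨f (q.symm i) ⟨a, hi⟩, by rw [Equiv.symm_apply_apply]⟩
  have hinj : ∀ i s j t, (((f (q.symm i)).symm s).1 : P) = ((f (q.symm j)).symm t).1 →
      i = j ∧ s = t := by
    intro i s j t hst
    have hst' := Subtype.ext hst
    have hij : i = j := by
      have := hcls i s
      rw [hst', hcls j t] at this
      exact (q.symm.injective this).symm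
    subst hij
    exact ⟨rfl, (f (q.symm i)).symm.injective (Subtype.ext hst')⟩
  refine ⟨_, fun i s => (((f (q.symm i)).symm s).1 : P), hinj, ?_, ?_, ?_, ?_, ?_⟩
  · intro a
    constructor
    · intro ha
      obtain ⟨s, hs⟩ := hmem ⟨a, ha⟩ (q ⟦⟨a, ha⟩⟧) (by rw [Equiv.symm_apply_apply])
      exact ⟨_, s, congrArg Subtype.val hs⟩
    · rintro ⟨i, s, rfl⟩
      exact ((f (q.symm i)).symm s).1.2
  · intro z hxz hzy
    obtain ⟨a, ha⟩ := atomsIn_nonempty hxz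
    refine ⟨q ⟦⟨a, atomsIn_mono hzy.le ha⟩⟧, fun b hb => ?_⟩
    obtain ⟨s, hs⟩ := hmem ⟨b, atomsIn_mono hzy.le hb⟩ (q ⟦⟨a, atomsIn_mono hzy.le ha⟩⟧) (by
      rw [Equiv.symm_apply_apply]
      exact (hr _ _).2 (h.haveCommonCover_of_mem hzy hb ha))
    exact ⟨s, congrArg Subtype.val hs⟩
  · intro i S ⟨s, hs⟩ hS
    obtain ⟨t, ht⟩ : ∃ t, t ∉ S := by
      by_contra! hcon
      exact hS (Finset.eq_univ_iff_forall.2 hcon)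
    have hcc : ∀ t, HaveCommonCover y (((f (q.symm i)).symm s).1 : P)
        ((f (q.symm i)).symm t).1 := fun t => (hr _ _).1 ((hcls i s).trans (hcls i t).symm)
    refine h.exists_atomsIn_eq hk (a := ((f (q.symm i)).symm s).1)
      (b := ((f (q.symm i)).symm t).1) (Finset.mem_image_of_mem _ hs) ?_
      ((f (q.symm i)).symm t).1.2 (hcc t) ?_
    · intro c hc
      obtain ⟨u, -, rfl⟩ := Finset.mem_image.1 hc
      exact ⟨((f (q.symm i)).symm u).1.2, hcc u⟩
    · intro hc
      obtain ⟨u, hu, hut⟩ := Finset.mem_image.1 hc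
      obtain rfl := (hinj _ _ _ _ hut).2
      exact ht hu
  · intro z w hxz hzy _ hwy
    exact h.le_of_atomsIn_subset hk h3 hxz hzy hwy
  · intro z hxz hzy
    have g1 := grade_lt_of_lt hzy
    have g2 := grade_lt_of_lt hxz
    have g3 := h.rank
    rw [h.card_lower z hxz.le hzy]
    omega

end IsLocallyBoolean

/-! ### Sums with a single summand, and intervals of small rank -/

section BooleanSum

variable [DecidableEq P] {α : ℕ} {e : Fin α → Fin k → P}

omit [GradeMinOrder ℕ P] in
theorem IsBooleanSum.card_atomsIn (h : IsBooleanSum x y e) : #(atomsIn x y) = α * k := by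
  have : atomsIn x y = univ.image fun p : Fin α × Fin k => e p.1 p.2 := by
    ext a
    simp [h.mem_iff]
  rw [this, Finset.card_image_of_injective, Finset.card_univ, Fintype.card_prod, Fintype.card_fin,
    Fintype.card_fin]
  rintro ⟨i, s⟩ ⟨j, t⟩ hst
  obtain ⟨rfl, rfl⟩ := h.inj i s j t hst
  rfl

theorem IsBooleanSum.isBooleanInterval {e : Fin 1 → Fin k → P} (h : IsBooleanSum x y e)
    (hxy : x ≤ y) : IsBooleanInterval x y := by
  have hcard := h.card_atomsIn
  rw [one_mul] at hcard
  have himg : atomsIn x y = univ.image (e 0) := by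
    ext a
    simp only [h.mem_iff, Fin.exists_fin_one, Finset.mem_image, Finset.mem_univ, true_and]
  refine ⟨?_, ?_⟩
  · intro z w hxz hzy hxw hwy hsub
    rcases hxz.eq_or_lt with rfl | hxz
    · exact hxw
    rcases hwy.eq_or_lt with rfl | hwy
    · exact hzy
    rcases hxw.eq_or_lt with rfl | hxw
    · obtain ⟨a, ha⟩ := atomsIn_nonempty hxz
      have := hsub ha
      rw [atomsIn_self] at this
      simp at this
    -- If `z` is the top, it has all `k` atoms below it, more than any proper `w`.
    rcases hzy.eq_or_lt with rfl | hzy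
    · have h1 := Finset.card_le_card hsub
      have h2 := h.card_lt w hxw hwy
      omega
    exact h.le_of_subset z w hxz hzy hxw hwy hsub
  · intro S hS
    rcases S.eq_empty_or_nonempty with rfl | hne
    · exact ⟨x, le_rfl, hxy, atomsIn_self x⟩
    rcases eq_or_ne S (atomsIn x y) with rfl | hne'
    · exact ⟨y, hxy, le_rfl, rfl⟩
    rw [himg] at hS
    obtain ⟨T, -, rfl⟩ := Finset.subset_image_iff.1 hS
    obtain ⟨z, h1, h2, h3⟩ := h.exists_eq 0 T (Finset.image_nonempty.1 hne) (by
      rintro rfl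
      exact hne' himg.symm)
    exact ⟨z, h1.le, h2.le, h3⟩

end BooleanSum

/-- Intervals of rank at most two are boolean if they have as many atoms as their rank. -/
theorem isBooleanInterval_of_rank_le_two (hxy : x ≤ y) (hk : grade ℕ y = grade ℕ x + k)
    (hk2 : k ≤ 2) (hc : #(atomsIn x y) = k) : IsBooleanInterval x y := by
  classical
  have hmid : ∀ z, x ≤ z → z ≤ y → z = x ∨ x ⋖ z ∨ z = y := by
    intro z h1 h2
    rcases eq_or_ne z y with rfl | hne
    · exact Or.inr (Or.inr rfl)
    have g1 := grade_lt_of_lt (lt_of_le_of_ne h2 hne)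
    have g2 := grade_le_of_le h1
    rcases eq_or_ne (grade ℕ z) (grade ℕ x) with g | g
    · exact Or.inl (eq_of_le_of_grade_eq h1 g.symm).symm
    · exact Or.inr (Or.inl (covBy_of_le_of_grade h1 (by omega)))
  refine ⟨?_, ?_⟩
  · intro z w hxz hzy hxw hwy hsub
    rcases hmid z hxz hzy with rfl | hz | rfl
    · exact hxw
    · exact (mem_atomsIn.1 (hsub (mem_atomsIn.2 ⟨hz, le_rfl⟩))).2
    · rcases hmid w hxw hwy with rfl | hw | rfl
      · rw [atomsIn_self, Finset.subset_empty] at hsub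
        rw [hsub, Finset.card_empty] at hc
        exact (eq_of_le_of_grade_eq hwy (by omega)).ge
      · have h1 := Finset.card_le_card hsub
        rw [atomsIn_of_covBy hw, Finset.card_singleton] at h1
        have := grade_of_covBy hw
        exact (eq_of_le_of_grade_eq hwy (by have := grade_le_of_le hwy; omega)).ge
      · exact le_rfl
  · intro S hS
    rcases S.eq_empty_or_nonempty with rfl | ⟨a, ha⟩
    · exact ⟨x, le_rfl, hxy, atomsIn_self x⟩
    rcases eq_or_ne S (atomsIn x y) with rfl | hne
    · exact ⟨y, hxy, le_rfl, rfl⟩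
    have hlt := Finset.card_lt_card (Finset.ssubset_iff_subset_ne.2 ⟨hS, hne⟩)
    have h1 : #S = 1 := by
      have := Finset.card_pos.2 ⟨a, ha⟩
      omega
    obtain ⟨b, rfl⟩ := Finset.card_eq_one.1 h1
    have hb := mem_atomsIn.1 (hS (Finset.mem_singleton_self b))
    exact ⟨b, hb.1.le, hb.2, atomsIn_of_covBy hb.1⟩

end LocallyBoolean

/-! ### Alternating sums -/

theorem sum_neg_one_pow_div_factorial {k : ℕ} (hk : k ≠ 0) :
    ∑ i ∈ range (k + 1), (-1 : ℚ) ^ i / (i.factorial * (k - i).factorial) = 0 := by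
  have h := Int.alternating_sum_range_choose_of_ne hk
  have h' : ∑ i ∈ range (k + 1), (-1 : ℚ) ^ i * (k.choose i) = 0 := by
    have := congrArg (Int.cast : ℤ → ℚ) h
    push_cast at this
    exact this
  rw [← zero_div (k.factorial : ℚ), ← h', Finset.sum_div]
  refine Finset.sum_congr rfl fun i hi => ?_
  have hi' : i ≤ k := by rw [Finset.mem_range] at hi; omega
  have h1 : (k.factorial : ℚ) ≠ 0 := by exact_mod_cast k.factorial_ne_zero
  have h2 : (i.factorial : ℚ) ≠ 0 := by exact_mod_cast i.factorial_ne_zero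
  have h3 : ((k - i).factorial : ℚ) ≠ 0 := by exact_mod_cast (k - i).factorial_ne_zero
  rw [Nat.cast_choose ℚ hi']
  field_simp

/-- Against the binomial identity only the terms `i = 0` and `i = k` survive, with equal signs
because `k` is even: `2 / B k = 2 / k!`. -/
theorem eq_factorial_of_even {B : ℕ → ℕ} {k : ℕ} (hk : Even k) (hk0 : k ≠ 0)
    (hB : ∀ i < k, B i = i.factorial)
    (hsum : ∑ i ∈ range (k + 1), (-1 : ℚ) ^ i / (B i * B (k - i) : ℕ) = 0) :
    B k = k.factorial := by
  have h := sum_neg_one_pow_div_factorial hk0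
  have hd : ∑ i ∈ range (k + 1), ((-1 : ℚ) ^ i / (B i * B (k - i) : ℕ) -
      (-1 : ℚ) ^ i / (i.factorial * (k - i).factorial)) = 0 := by
    rw [Finset.sum_sub_distrib, hsum, h, sub_zero]
  rw [← Finset.sum_subset (s₁ := {0, k})] at hd
  · rw [Finset.sum_pair hk0.symm] at hd
    simp only [Nat.sub_zero, Nat.sub_self, hk.neg_one_pow, pow_zero, hB 0 (by omega),
      Nat.factorial_zero, one_mul, mul_one, Nat.cast_one] at hd
    have : (1 : ℚ) / B k = 1 / k.factorial := by linarith
    rw [one_div, one_div, inv_inj] at this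
    exact_mod_cast this
  · intro i hi
    simp only [Finset.mem_insert, Finset.mem_singleton] at hi
    simp only [Finset.mem_range]
    omega
  · intro i hi hi'
    simp only [Finset.mem_insert, Finset.mem_singleton, not_or] at hi'
    rw [Finset.mem_range] at hi
    rw [hB i (by omega), hB (k - i) (by omega)]
    push_cast
    ring

/-- The surviving terms give `1 / B (k + 1) = 1 / (k + 1)! + 1 / (α * k!) - 1 / k!`. For `α ≥ 2`
both positive terms on the right are at most `1 / (2 * k!)`, so the right side is not positive. -/
theorem eq_one_of_odd {B : ℕ → ℕ} {k α : ℕ} (hk : Odd k) (hk3 : 3 ≤ k)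
    (hB : ∀ i < k, B i = i.factorial) (hα : B k = α * k.factorial) (hα0 : 0 < α)
    (hpos : 0 < B (k + 1))
    (hsum : ∑ i ∈ range (k + 1 + 1), (-1 : ℚ) ^ i / (B i * B (k + 1 - i) : ℕ) = 0) :
    α = 1 := by
  have h := sum_neg_one_pow_div_factorial (k := k + 1) (by omega)
  have hd : ∑ i ∈ range (k + 1 + 1), ((-1 : ℚ) ^ i / (B i * B (k + 1 - i) : ℕ) -
      (-1 : ℚ) ^ i / (i.factorial * (k + 1 - i).factorial)) = 0 := by
    rw [Finset.sum_sub_distrib, hsum, h, sub_zero]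
  rw [← Finset.sum_subset (s₁ := {0, 1, k, k + 1})] at hd
  · have e1 : (-1 : ℚ) ^ (k + 1) = 1 := hk.add_one.neg_one_pow
    rw [Finset.sum_insert (by simp; omega), Finset.sum_insert (by simp; omega),
      Finset.sum_pair (by omega), hk.neg_one_pow, e1] at hd
    simp only [Nat.sub_zero, Nat.sub_self, Nat.add_sub_cancel, Nat.add_sub_cancel_left, pow_zero,
      pow_one, hB 0 (by omega), hB 1 (by omega), Nat.factorial_zero, Nat.factorial_one, one_mul,
      mul_one, Nat.cast_one, hα] at hd
    have hB1 : (0 : ℚ) < 1 / B (k + 1) := by positivity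
    have hf : (0 : ℚ) < k.factorial := by exact_mod_cast k.factorial_pos
    rw [Nat.factorial_succ] at hd
    push_cast at hd
    by_contra hne
    have hα2 : (2 : ℚ) ≤ α := by exact_mod_cast (show 2 ≤ α by omega)
    have hk3' : (3 : ℚ) ≤ k := by exact_mod_cast hk3
    have i1 : (1 : ℚ) / ((k + 1) * k.factorial) ≤ 1 / (2 * k.factorial) := by
      apply one_div_le_one_div_of_le (by positivity)
      nlinarith
    have i2 : (1 : ℚ) / (α * k.factorial) ≤ 1 / (2 * k.factorial) := by
      apply one_div_le_one_div_of_le (by positivity)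
      nlinarith
    have i3 : (1 : ℚ) / (2 * k.factorial) + 1 / (2 * k.factorial) = 1 / k.factorial := by
      field_simp
      norm_num
    simp only [neg_div] at hd
    linarith
  · intro i hi
    simp only [Finset.mem_insert, Finset.mem_singleton] at hi
    simp only [Finset.mem_range]
    omega
  · intro i hi hi'
    simp only [Finset.mem_insert, Finset.mem_singleton, not_or] at hi'
    rw [Finset.mem_range] at hi
    rw [hB i (by omega), hB (k + 1 - i) (by omega)]
    push_cast
    ring

/-! ### The binomial factorial function -/

/-- `B k = k!`, and all intervals of rank `k` with nonzero bottom are boolean lattices. -/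
def IsBooleanAt (P : Type*) [PartialOrder P] [BoundedOrder P] [GradeMinOrder ℕ P] [Fintype P]
    (B : ℕ → ℕ) (k : ℕ) : Prop :=
  B k = k.factorial ∧ ∀ x y : P, x ≠ ⊥ → x ≤ y → grade ℕ y = grade ℕ x + k →
    IsBooleanInterval x y

section Binomial

variable {P : Type*} [PartialOrder P] [BoundedOrder P] [GradeMinOrder ℕ P] [Fintype P]
  {B : ℕ → ℕ} {n k : ℕ}

omit [Fintype P] in
theorem grade_bot_nat : grade ℕ (⊥ : P) = 0 := grade_bot

omit [Fintype P] in
theorem ne_bot_of_grade_pos {x : P} (h : 0 < grade ℕ x) : x ≠ ⊥ := by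
  rintro rfl
  rw [grade_bot_nat] at h
  exact h.false

theorem exists_grade_eq (hn : grade ℕ (⊤ : P) = n) (hk : k ≤ n) : ∃ x : P, grade ℕ x = k := by
  obtain ⟨x, hx⟩ := levelIn_nonempty (x := (⊥ : P)) bot_le (y := ⊤) (i := k)
    (by rw [grade_bot_nat, hn]; omega)
  exact ⟨x, by rw [(mem_levelIn.1 hx).2.2, grade_bot_nat, zero_add]⟩

/-- Starting at rank 1 realises every length below `n`, so the Euler relation for `B` is available
for all these lengths. -/
theorem exists_interval (hn : grade ℕ (⊤ : P) = n) (hk : k < n) :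
    ∃ x y : P, x ≠ ⊥ ∧ x ≤ y ∧ grade ℕ y = grade ℕ x + k := by
  obtain ⟨x, hx⟩ := exists_grade_eq (P := P) hn (k := 1) (by omega)
  obtain ⟨y, hy⟩ := levelIn_nonempty (x := x) le_top (y := ⊤) (i := k) (by omega)
  rw [mem_levelIn] at hy
  exact ⟨x, y, ne_bot_of_grade_pos (by omega), hy.1, hy.2.2⟩

namespace IsBinomialFactorialFunction

omit [Fintype P] in
theorem eq_of_rank (hB : IsBinomialFactorialFunction P B) {x y : P} (hx : x ≠ ⊥) (hxy : x ≤ y)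
    (hk : grade ℕ y = grade ℕ x + k) : numMaxChains x y = B k := by
  rw [hB x y hx hxy, hk, Nat.add_sub_cancel_left]

theorem pos (hB : IsBinomialFactorialFunction P B) (hn : grade ℕ (⊤ : P) = n) (hk : k < n) :
    0 < B k := by
  obtain ⟨x, y, hx, hxy, hr⟩ := exists_interval (P := P) hn hk
  rw [← hB.eq_of_rank hx hxy hr]
  exact numMaxChains_pos x y

omit [Fintype P] in
theorem zero (hB : IsBinomialFactorialFunction P B) (hn : grade ℕ (⊤ : P) = n) (h0 : 0 < n) :
    B 0 = 1 := by
  rw [← hB.eq_of_rank (x := (⊤ : P)) (y := ⊤) (ne_bot_of_grade_pos (by omega)) le_rfl rfl,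
    numMaxChains_self]

theorem card_atomsIn_mul (hB : IsBinomialFactorialFunction P B) {x y : P} (hx : x ≠ ⊥)
    (hxy : x ≤ y) (hk : grade ℕ y = grade ℕ x + (k + 1)) :
    #(atomsIn x y) * B k = B (k + 1) := by
  have hlt : x < y := lt_of_le_of_ne hxy (by rintro rfl; omega)
  rw [← hB.eq_of_rank hx hxy hk, numMaxChains_eq_sum hlt, ← smul_eq_mul, ← Finset.sum_const]
  refine Finset.sum_congr rfl fun a ha => ?_
  rw [mem_atomsIn] at ha
  have := grade_of_covBy ha.1
  exact (hB.eq_of_rank (ne_bot_of_grade_pos (by omega)) ha.2 (by omega)).symm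

theorem one (hB : IsBinomialFactorialFunction P B) (hn : grade ℕ (⊤ : P) = n) (h1 : 1 < n) :
    B 1 = 1 := by
  obtain ⟨x, y, hx, hxy, hr⟩ := exists_interval (P := P) hn h1
  rw [← hB.card_atomsIn_mul hx hxy hr, hB.zero hn (by omega),
    atomsIn_of_covBy (covBy_of_le_of_grade hxy hr), Finset.card_singleton]

theorem sum_eq_zero (hB : IsBinomialFactorialFunction P B) (hE : IsEulerianPoset P)
    (hn : grade ℕ (⊤ : P) = n) (hk0 : 0 < k) (hk : k < n) :
    ∑ i ∈ range (k + 1), (-1 : ℚ) ^ i / (B i * B (k - i) : ℕ) = 0 := by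
  obtain ⟨x, y, hx, hxy, hr⟩ := exists_interval (P := P) hn hk
  have hlt : x < y := lt_of_le_of_ne hxy (by rintro rfl; omega)
  refine hE.sum_eq_zero hlt hr (fun i => B i * B (k - i)) fun z hxz hzy => ?_
  have hz : z ≠ ⊥ := fun h => hx (le_bot_iff.1 (h ▸ hxz))
  have g1 := grade_le_of_le hxz
  have g2 := grade_le_of_le hzy
  rw [hB.eq_of_rank hx hxz (k := grade ℕ z - grade ℕ x) (by omega),
    hB.eq_of_rank hz hzy (k := k - (grade ℕ z - grade ℕ x)) (by omega)]

theorem card_atomsIn_of_factorial (hB : IsBinomialFactorialFunction P B) {x y : P} (hx : x ≠ ⊥)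
    (hxy : x ≤ y) (hr : grade ℕ y = grade ℕ x + k) (h : ∀ i ≤ k, B i = i.factorial) :
    #(atomsIn x y) = k := by
  rcases k with _ | k
  · obtain rfl := eq_of_le_of_grade_eq hxy hr.symm
    rw [atomsIn_self, Finset.card_empty]
  · have h1 := hB.card_atomsIn_mul hx hxy hr
    rw [h k (by omega), h (k + 1) le_rfl, Nat.factorial_succ] at h1
    exact Nat.eq_of_mul_eq_mul_right k.factorial_pos h1

theorem isLocallyBoolean (hB : IsBinomialFactorialFunction P B) (h : ∀ i < k, IsBooleanAt P B i)
    {x y : P} (hx : x ≠ ⊥) (hxy : x ≤ y) (hr : grade ℕ y = grade ℕ x + k) :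
    IsLocallyBoolean x y k := by
  refine ⟨hxy, hr, ?_, ?_, ?_, ?_⟩
  · intro z hxz hzy
    have g1 := grade_le_of_le hxz
    have g2 := grade_lt_of_lt hzy
    exact (h (grade ℕ z - grade ℕ x) (by omega)).2 x z hx hxz (by omega)
  · intro z hxz hzy
    have g1 := grade_le_of_le hxz
    have g2 := grade_lt_of_lt hzy
    exact hB.card_atomsIn_of_factorial hx hxz (by omega) fun i hi => (h i (by omega)).1
  · intro a ha
    rw [mem_atomsIn] at ha
    have g1 := grade_of_covBy ha.1
    have g2 := grade_le_of_le ha.2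
    exact (h (k - 1) (by omega)).2 a y (ne_bot_of_grade_pos (by omega)) ha.2 (by omega)
  · intro a ha
    rw [mem_atomsIn] at ha
    have g1 := grade_of_covBy ha.1
    have g2 := grade_le_of_le ha.2
    exact hB.card_atomsIn_of_factorial (ne_bot_of_grade_pos (by omega)) ha.2 (by omega)
      fun i hi => (h i (by omega)).1

theorem two (hB : IsBinomialFactorialFunction P B) (hE : IsEulerianPoset P)
    (hn : grade ℕ (⊤ : P) = n) (h2 : 2 < n) : B 2 = 2 := by
  refine eq_factorial_of_even even_two (by omega) ?_
    (hB.sum_eq_zero hE hn (by omega) h2)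
  intro i hi
  interval_cases i
  · exact hB.zero hn (by omega)
  · exact hB.one hn (by omega)

theorem exists_isBooleanSum [DecidableEq P] (hB : IsBinomialFactorialFunction P B)
    (h : ∀ i < k, IsBooleanAt P B i) (hn : grade ℕ (⊤ : P) = n)
    (hB3 : B 3 = 6) (hk3 : 3 ≤ k) (hk : k < n)
    {x y : P} (hx : x ≠ ⊥) (hxy : x ≤ y) (hr : grade ℕ y = grade ℕ x + k) :
    ∃ (α : ℕ) (e : Fin α → Fin k → P), IsBooleanSum x y e ∧ 0 < α ∧ B k = α * k.factorial := by
  have hlb := hB.isLocallyBoolean h hx hxy hr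
  -- In rank 3, `B 3 = 6` and `B 2 = 2` leave exactly three atoms.
  obtain ⟨α, e, he⟩ := hlb.exists_isBooleanSum hk3 (by
    rintro rfl
    have h1 := hB.card_atomsIn_mul hx hxy hr
    rw [(h 2 (by omega)).1, hB3] at h1
    norm_num [Nat.factorial] at h1
    omega)
  have hBk : B k = α * k.factorial := by
    obtain ⟨j, rfl⟩ : ∃ j, k = j + 1 := ⟨k - 1, by omega⟩
    rw [← hB.card_atomsIn_mul hx hxy hr, he.card_atomsIn, (h j (by omega)).1, Nat.factorial_succ,
      mul_assoc]
  refine ⟨α, e, he, ?_, hBk⟩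
  have := hB.pos hn hk
  rw [hBk] at this
  exact Nat.pos_of_mul_pos_right this

/-- In an Eulerian poset whose binomial factorial function takes the value `6` at `3`,
all intervals with nonzero bottom that are not too long are boolean lattices. -/
theorem isBooleanAt (hB : IsBinomialFactorialFunction P B) (hE : IsEulerianPoset P)
    (hn : grade ℕ (⊤ : P) = n) (hB3 : B 3 = 6) (hk : k + 2 ≤ n) : IsBooleanAt P B k := by
  classical
  induction k using Nat.strong_induction_on with
  | _ k ih =>
    have h : ∀ i < k, IsBooleanAt P B i := fun i hi => ih i hi (by omega)
    rcases Nat.lt_or_ge k 3 with hk3 | hk3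
    · have hBi : ∀ i ≤ k, B i = i.factorial := by
        intro i hi
        have hi3 : i < 3 := by omega
        interval_cases i
        · exact hB.zero hn (by omega)
        · exact hB.one hn (by omega)
        · exact hB.two hE hn (by omega)
      exact ⟨hBi k le_rfl, fun x y hx hxy hr => isBooleanInterval_of_rank_le_two hxy hr (by omega)
        (hB.card_atomsIn_of_factorial hx hxy hr hBi)⟩
    · have hBk : B k = k.factorial := by
        rcases Nat.even_or_odd k with hev | hodd
        · exact eq_factorial_of_even hev (by omega) (fun i hi => (h i hi).1)
            (hB.sum_eq_zero hE hn (by omega) (by omega))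
        -- For odd `k` the terms `i` and `k - i` cancel identically, so the relation of length `k +
        -- 1` is used; this requires `k + 2 ≤ n`.
        · obtain ⟨x, y, hx, hxy, hr⟩ := exists_interval (P := P) hn (k := k) (by omega)
          obtain ⟨α, e, -, hα0, hα⟩ := hB.exists_isBooleanSum h hn hB3 hk3 (by omega) hx hxy hr
          have := eq_one_of_odd hodd hk3 (fun i hi => (h i hi).1) hα hα0
            (hB.pos hn (by omega)) (hB.sum_eq_zero hE hn (by omega) (by omega))
          rw [hα, this, one_mul]
      refine ⟨hBk, fun x y hx hxy hr => ?_⟩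
      obtain ⟨α, e, he, -, hα⟩ := hB.exists_isBooleanSum h hn hB3 hk3 (by omega) hx hxy hr
      have h1 : α = 1 := by
        rw [hBk] at hα
        exact Nat.eq_of_mul_eq_mul_right k.factorial_pos (by rw [one_mul, ← hα])
      subst h1
      exact he.isBooleanInterval hxy

/-- The new case is `k = n - 1`, where `B k = α * k!` with `α` not determined; the lower bound
suffices for the study of `D`. -/
theorem factorial_le (hB : IsBinomialFactorialFunction P B) (hE : IsEulerianPoset P)
    (hn : grade ℕ (⊤ : P) = n) (hB3 : B 3 = 6) (hk : k < n) : k.factorial ≤ B k := by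
  classical
  rcases Nat.lt_or_ge (k + 1) n with hk' | hk'
  · exact (hB.isBooleanAt hE hn hB3 hk').1.ge
  have h : ∀ i < k, IsBooleanAt P B i := fun i hi => hB.isBooleanAt hE hn hB3 (by omega)
  rcases Nat.lt_or_ge k 3 with hk3 | hk3
  · interval_cases k
    · exact (hB.zero hn hk).ge
    · exact (hB.one hn hk).ge
    · exact (hB.two hE hn hk).ge
  · obtain ⟨x, y, hx, hxy, hr⟩ := exists_interval (P := P) hn hk
    obtain ⟨α, e, -, hα0, hα⟩ := hB.exists_isBooleanSum h hn hB3 hk3 hk hx hxy hr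
    rw [hα]
    exact Nat.le_mul_of_pos_left _ hα0

end IsBinomialFactorialFunction

end Binomial

/-! ### The Sheffer factorial function -/

/-- Comparison sum for `D i = 2 * (i - 1)!` and `B i = i!`, with the term `i = 0` left out; an index
shift reduces it to the binomial identity for `k - 1`. -/
theorem sum_neg_one_pow_div_two_mul_factorial {k : ℕ} (hk : 2 ≤ k) :
    ∑ i ∈ range (k + 1), (if i = 0 then (0 : ℚ) else
      (-1) ^ i / (2 * (i - 1).factorial * (k - i).factorial)) = 0 := by
  obtain ⟨j, rfl⟩ : ∃ j, k = j + 1 := ⟨k - 1, by omega⟩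
  rw [Finset.sum_range_succ', if_pos rfl, add_zero,
    ← mul_zero (-1 / 2 : ℚ), ← sum_neg_one_pow_div_factorial (k := j) (by omega), Finset.mul_sum]
  refine Finset.sum_congr rfl fun i _ => ?_
  have h2 : (i.factorial : ℚ) ≠ 0 := by exact_mod_cast i.factorial_ne_zero
  have h3 : ((j - i).factorial : ℚ) ≠ 0 := by exact_mod_cast (j - i).factorial_ne_zero
  rw [if_neg (by omega), Nat.add_sub_cancel, Nat.add_sub_add_right, pow_succ]
  field_simp

/-- The comparison terms at `i = 1` and `i = k` cancel each other, leaving `2 / D k = 1 / B (k -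
1)`. The value of `B (k - 1)` is left open so that this applies at the top rank. -/
theorem eq_two_mul_of_even {B D : ℕ → ℕ} {k : ℕ} (hk : Even k) (hk2 : 2 ≤ k)
    (hB : ∀ i < k - 1, B i = i.factorial) (hB0 : B 0 = 1) (hD1 : D 1 = 1)
    (hD : ∀ i, 2 ≤ i → i < k → D i = 2 * (i - 1).factorial) (hBpos : 0 < B (k - 1))
    (hDpos : 0 < D k)
    (hsum : ∑ i ∈ range (k + 1), (-1 : ℚ) ^ i /
      ((if i = 0 then D k else D i * B (k - i) : ℕ) : ℚ) = 0) :
    D k = 2 * B (k - 1) := by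
  have h := sum_neg_one_pow_div_two_mul_factorial hk2
  have hd : ∑ i ∈ range (k + 1), ((-1 : ℚ) ^ i /
      ((if i = 0 then D k else D i * B (k - i) : ℕ) : ℚ) - (if i = 0 then (0 : ℚ) else
      (-1) ^ i / (2 * (i - 1).factorial * (k - i).factorial))) = 0 := by
    rw [Finset.sum_sub_distrib, hsum, h, sub_zero]
  rw [← Finset.sum_subset (s₁ := {0, 1, k})] at hd
  · rw [Finset.sum_insert (by simp; omega), Finset.sum_pair (by omega), hk.neg_one_pow] at hd
    rw [if_pos rfl, if_pos rfl, if_neg one_ne_zero, if_neg one_ne_zero, if_neg (by omega),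
      if_neg (by omega)] at hd
    simp only [Nat.sub_self, pow_zero, pow_one, hB0, hD1, Nat.factorial_zero, one_mul,
      mul_one, Nat.cast_one, sub_zero] at hd
    have hb : (0 : ℚ) < B (k - 1) := by exact_mod_cast hBpos
    have hd0 : (0 : ℚ) < D k := by exact_mod_cast hDpos
    simp only [neg_div] at hd
    have h1 : (2 : ℚ) / D k = 1 / B (k - 1) := by
      rw [show (2 : ℚ) / D k = 1 / D k + 1 / D k by ring]
      linarith
    rw [div_eq_div_iff hd0.ne' hb.ne'] at h1
    have h2 : 2 * B (k - 1) = 1 * D k := by exact_mod_cast h1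
    omega
  · intro i hi
    simp only [Finset.mem_insert, Finset.mem_singleton] at hi
    simp only [Finset.mem_range]
    omega
  · intro i hi hi'
    simp only [Finset.mem_insert, Finset.mem_singleton, not_or] at hi'
    rw [Finset.mem_range] at hi
    rw [if_neg hi'.1, if_neg hi'.1, hD i (by omega) (by omega), hB (k - i) (by omega)]
    push_cast
    ring

/-- What survives is `2 / D (k + 1) = 1 / B k + 1 / (A * (k - 1)!) - 1 / (2 * (k - 1)!)`. With `A ≥
4` and `B k ≥ 5 * (k - 1)!` the right side is negative, as `1/5 + 1/4 < 1/2`. Parity excludes `A =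
3`, which this estimate would allow since `1/5 + 1/3 > 1/2`. -/
theorem eq_two_of_odd {B D : ℕ → ℕ} {k A : ℕ} (hk : Odd k) (hk5 : 5 ≤ k)
    (hB : ∀ i < k, B i = i.factorial) (hBk : k.factorial ≤ B k) (hD1 : D 1 = 1)
    (hD : ∀ i, 2 ≤ i → i < k → D i = 2 * (i - 1).factorial) (hDk : D k = A * (k - 1).factorial)
    (hA : Even A) (hDpos : 0 < D k) (hDpos' : 0 < D (k + 1))
    (hsum : ∑ i ∈ range (k + 1 + 1), (-1 : ℚ) ^ i /
      ((if i = 0 then D (k + 1) else D i * B (k + 1 - i) : ℕ) : ℚ) = 0) :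
    A = 2 := by
  have h := sum_neg_one_pow_div_two_mul_factorial (k := k + 1) (by omega)
  have hd : ∑ i ∈ range (k + 1 + 1), ((-1 : ℚ) ^ i /
      ((if i = 0 then D (k + 1) else D i * B (k + 1 - i) : ℕ) : ℚ) - (if i = 0 then (0 : ℚ) else
      (-1) ^ i / (2 * (i - 1).factorial * (k + 1 - i).factorial))) = 0 := by
    rw [Finset.sum_sub_distrib, hsum, h, sub_zero]
  have hA0 : 0 < A := by
    rw [hDk] at hDpos
    exact Nat.pos_of_mul_pos_right hDpos
  by_contra hne
  have hA4 : 4 ≤ A := by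
    obtain ⟨r, rfl⟩ := hA
    omega
  rw [← Finset.sum_subset (s₁ := {0, 1, k, k + 1})] at hd
  · have e1 : (-1 : ℚ) ^ (k + 1) = 1 := hk.add_one.neg_one_pow
    rw [Finset.sum_insert (by simp; omega), Finset.sum_insert (by simp; omega),
      Finset.sum_pair (by omega), hk.neg_one_pow, e1] at hd
    rw [if_pos rfl, if_pos rfl, if_neg one_ne_zero, if_neg one_ne_zero, if_neg (by omega),
      if_neg (by omega), if_neg (by omega), if_neg (by omega)] at hd
    simp only [Nat.sub_self, Nat.add_sub_cancel, Nat.add_sub_cancel_left, pow_zero, pow_one,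
      hB 0 (by omega), hB 1 (by omega), hD1, hDk, Nat.factorial_zero, Nat.factorial_one, one_mul,
      mul_one, Nat.cast_one, sub_zero] at hd
    obtain ⟨j, rfl⟩ : ∃ j, k = j + 1 := ⟨k - 1, by omega⟩
    simp only [Nat.add_sub_cancel] at hd
    have hf : (0 : ℚ) < j.factorial := by exact_mod_cast j.factorial_pos
    have hj : (4 : ℚ) ≤ j := by exact_mod_cast (show 4 ≤ j by omega)
    have hA' : (4 : ℚ) ≤ A := by exact_mod_cast hA4
    have hB' : (5 : ℚ) * j.factorial ≤ B (j + 1) := by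
      rw [Nat.factorial_succ] at hBk
      have hBk' : ((j + 1 : ℕ) * j.factorial : ℚ) ≤ B (j + 1) := by exact_mod_cast hBk
      push_cast at hBk'
      nlinarith
    have hDp : (0 : ℚ) < 1 / D (j + 1 + 1) := by positivity
    have i1 : (1 : ℚ) / B (j + 1) ≤ 1 / (5 * j.factorial) :=
      one_div_le_one_div_of_le (by positivity) hB'
    have i2 : (1 : ℚ) / (A * j.factorial) ≤ 1 / (4 * j.factorial) := by
      apply one_div_le_one_div_of_le (by positivity)
      nlinarith
    have i3 : (1 : ℚ) / (5 * j.factorial) + 1 / (4 * j.factorial) < 1 / (2 * j.factorial) := by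
      rw [show (1 : ℚ) / (5 * j.factorial) = (1 / 5) * (1 / j.factorial) by field_simp,
        show (1 : ℚ) / (4 * j.factorial) = (1 / 4) * (1 / j.factorial) by field_simp,
        show (1 : ℚ) / (2 * j.factorial) = (1 / 2) * (1 / j.factorial) by field_simp]
      have : (0 : ℚ) < 1 / j.factorial := by positivity
      linarith
    simp only [neg_div] at hd
    push_cast at hd
    linarith
  · intro i hi
    simp only [Finset.mem_insert, Finset.mem_singleton] at hi
    simp only [Finset.mem_range]
    omega
  · intro i hi hi'
    simp only [Finset.mem_insert, Finset.mem_singleton, not_or] at hi'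
    rw [Finset.mem_range] at hi
    rw [if_neg hi'.1, if_neg hi'.1, hD i (by omega) (by omega), hB (k + 1 - i) (by omega)]
    push_cast
    ring

section Sheffer

variable {P : Type*} [PartialOrder P] [BoundedOrder P] [GradeMinOrder ℕ P] [Fintype P]
  {B D : ℕ → ℕ} {n k : ℕ}

namespace IsShefferFactorialFunction

theorem pos (hD : IsShefferFactorialFunction P D) (hn : grade ℕ (⊤ : P) = n) (hk : k ≤ n) :
    0 < D k := by
  obtain ⟨y, rfl⟩ := exists_grade_eq (P := P) hn hk
  rw [← hD y]
  exact numMaxChains_pos _ _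

theorem card_atomsIn_mul (hD : IsShefferFactorialFunction P D)
    (hB : IsBinomialFactorialFunction P B) {y : P} (hy : grade ℕ y = k + 1) :
    #(atomsIn ⊥ y) * B k = D (k + 1) := by
  rw [← hy, ← hD y, numMaxChains_eq_sum (bot_lt_iff_ne_bot.2 (ne_bot_of_grade_pos (by omega))),
    ← smul_eq_mul, ← Finset.sum_const]
  refine Finset.sum_congr rfl fun a ha => ?_
  rw [mem_atomsIn] at ha
  have h1 := grade_of_covBy ha.1
  rw [grade_bot_nat] at h1
  exact (hB.eq_of_rank (ne_bot_of_grade_pos (by omega)) ha.2 (by omega)).symm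

theorem one (hD : IsShefferFactorialFunction P D) (hB : IsBinomialFactorialFunction P B)
    (hn : grade ℕ (⊤ : P) = n) (h1 : 0 < n) : D 1 = 1 := by
  obtain ⟨y, hy⟩ := exists_grade_eq (P := P) hn (k := 1) h1
  rw [← hD.card_atomsIn_mul hB hy, hB.zero hn h1,
    atomsIn_of_covBy (covBy_of_le_of_grade bot_le (by rw [hy, grade_bot_nat])),
    Finset.card_singleton]

theorem sum_eq_zero (hD : IsShefferFactorialFunction P D) (hB : IsBinomialFactorialFunction P B)
    (hE : IsEulerianPoset P) (hn : grade ℕ (⊤ : P) = n) (hk0 : 0 < k) (hk : k ≤ n) :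
    ∑ i ∈ range (k + 1), (-1 : ℚ) ^ i /
      ((if i = 0 then D k else D i * B (k - i) : ℕ) : ℚ) = 0 := by
  obtain ⟨y, rfl⟩ := exists_grade_eq (P := P) hn hk
  refine hE.sum_eq_zero (bot_lt_iff_ne_bot.2 (ne_bot_of_grade_pos hk0))
    (by rw [grade_bot_nat, zero_add])
    (fun i => if i = 0 then D (grade ℕ y) else D i * B (grade ℕ y - i)) fun z _ hzy => ?_
  have g2 := grade_le_of_le hzy
  rcases eq_or_ne z ⊥ with rfl | hz
  · simp only [grade_bot_nat, Nat.sub_zero, if_true, numMaxChains_self, one_mul, hD y]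
  · have hz0 : grade ℕ z ≠ 0 := by
      intro h
      exact hz (eq_of_le_of_grade_eq bot_le (by rw [h, grade_bot_nat])).symm
    simp only [grade_bot_nat, Nat.sub_zero, if_neg hz0, hD z,
      hB.eq_of_rank hz hzy (k := grade ℕ y - grade ℕ z) (by omega)]

/-- The atoms of an interval `[⊥, y]` come in pairs if all proper elements of rank at least two lie
above exactly two atoms. -/
theorem even_card_atomsIn (hB : IsBinomialFactorialFunction P B) {y : P} (hk : 4 ≤ k)
    (hy : grade ℕ y = k) (hbool : ∀ i < k, IsBooleanAt P B i)
    (h2 : ∀ z < y, 2 ≤ grade ℕ z → #(atomsIn ⊥ z) = 2) : Even #(atomsIn ⊥ y) := by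
  classical
  have key : ∀ a ∈ atomsIn ⊥ y, ∃ b ∈ atomsIn ⊥ y, b ≠ a ∧
      ∃ p, a ⋖ p ∧ b ⋖ p ∧ p ≤ y ∧ ∀ q, a ⋖ q → q ≤ y → atomsIn ⊥ q = {a, b} := by
    intro a ha
    rw [mem_atomsIn] at ha
    have g1 := grade_of_covBy ha.1
    rw [grade_bot_nat] at g1
    have ha0 : a ≠ ⊥ := ne_bot_of_grade_pos (by omega)
    obtain ⟨p, hp⟩ := atomsIn_nonempty (lt_of_le_of_ne ha.2 (by rintro rfl; omega))
    have hp' := mem_atomsIn.1 hp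
    have g2 := grade_of_covBy hp'.1
    have hap : a ∈ atomsIn ⊥ p := mem_atomsIn.2 ⟨ha.1, hp'.1.le⟩
    have hpc := h2 p (lt_of_le_of_ne hp'.2 (by rintro rfl; omega)) (by omega)
    have hc1 : #((atomsIn ⊥ p).erase a) = 1 := by
      rw [Finset.card_erase_of_mem hap]; omega
    obtain ⟨b, hb⟩ := Finset.card_eq_one.1 hc1
    have hb' : b ∈ (atomsIn ⊥ p).erase a := by rw [hb]; exact Finset.mem_singleton_self b
    have hbp := mem_atomsIn.1 (Finset.mem_of_mem_erase hb')
    have g3 := grade_of_covBy hbp.1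
    rw [grade_bot_nat] at g3
    have hpe : atomsIn ⊥ p = {a, b} := by rw [← Finset.insert_erase hap, hb]
    refine ⟨b, mem_atomsIn.2 ⟨hbp.1, hbp.2.trans hp'.2⟩, Finset.ne_of_mem_erase hb', p, hp'.1,
      covBy_of_le_of_grade hbp.2 (by omega), hp'.2, fun q haq hq => ?_⟩
    -- As `k - 1 ≥ 3`, the join `r` of two covers of `a` in the boolean interval `[a, y]` is proper.
    -- It has just two atoms below it, so `p` and `q` have the same two.
    obtain ⟨r, har, hry, hr⟩ := ((hbool (k - 1) (by omega)).2 a y ha0 ha.2 (by omega)).exists_eq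
      {p, q} (by
        intro z hz
        rw [Finset.mem_insert, Finset.mem_singleton] at hz
        rcases hz with rfl | rfl
        · exact hp
        · exact mem_atomsIn.2 ⟨haq, hq⟩)
    have hpr : p ≤ r := (mem_atomsIn.1 (show p ∈ atomsIn a r by rw [hr]; simp)).2
    have hqr : q ≤ r := (mem_atomsIn.1 (show q ∈ atomsIn a r by rw [hr]; simp)).2
    have hrlt : r < y := by
      refine lt_of_le_of_ne hry ?_
      rintro rfl
      have h3 := hB.card_atomsIn_of_factorial ha0 ha.2 (k := k - 1) (by omega)
        fun i hi => (hbool i (by omega)).1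
      have := Finset.card_le_two (a := p) (b := q)
      rw [← hr] at this
      omega
    have hrc := h2 r hrlt (by have := grade_le_of_le hpr; omega)
    have hqc := h2 q (hqr.trans_lt hrlt) (by have := grade_of_covBy haq; omega)
    rw [← hpe, Finset.eq_of_subset_of_card_le (atomsIn_mono hpr) (by omega),
      Finset.eq_of_subset_of_card_le (atomsIn_mono hqr) (by omega)]
  choose! σ hσ hne p hap hbp hpy hq using key
  have hinv : ∀ a ∈ atomsIn ⊥ y, σ (σ a) = a := by
    intro a ha
    have h1 := hq a ha (p a) (hap a ha) (hpy a ha)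
    have h3 := hq (σ a) (hσ a ha) (p a) (hbp a ha) (hpy a ha)
    have : σ (σ a) ∈ ({a, σ a} : Finset P) := by
      rw [← h1, h3]; simp
    rw [Finset.mem_insert, Finset.mem_singleton] at this
    exact this.resolve_right (hne _ (hσ a ha))
  -- The partner map `σ` is an involution without fixed points, so the number of atoms vanishes
  -- modulo 2.
  have hsum : ∑ _a ∈ atomsIn ⊥ y, (1 : ZMod 2) = 0 :=
    Finset.sum_involution (fun a _ => σ a) (fun _ _ => by decide) (fun a ha _ => hne a ha)
      (fun a ha => hσ a ha) hinv
  rw [Finset.sum_const, nsmul_eq_mul, mul_one, ZMod.natCast_eq_zero_iff] at hsum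
  exact even_iff_two_dvd.2 hsum

theorem card_atomsIn_eq_two (hD : IsShefferFactorialFunction P D)
    (hB : IsBinomialFactorialFunction P B) (hn : grade ℕ (⊤ : P) = n) {z : P}
    (hz : 2 ≤ grade ℕ z) (hDz : D (grade ℕ z) = 2 * B (grade ℕ z - 1)) :
    #(atomsIn ⊥ z) = 2 := by
  have g := grade_le_of_le (le_top : z ≤ ⊤)
  have h := hD.card_atomsIn_mul hB (y := z) (k := grade ℕ z - 1) (by omega)
  rw [Nat.sub_add_cancel (by omega), hDz] at h
  exact Nat.eq_of_mul_eq_mul_right (hB.pos hn (by omega)) h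

theorem eq_two_mul_factorial (hD : IsShefferFactorialFunction P D)
    (hB : IsBinomialFactorialFunction P B) (hE : IsEulerianPoset P) (hn : grade ℕ (⊤ : P) = n)
    (hB3 : B 3 = 6) (hD3 : D 3 = 4) (hk2 : 2 ≤ k) (hk : k < n) :
    D k = 2 * (k - 1).factorial := by
  induction k using Nat.strong_induction_on with
  | _ k ih =>
    have hBi : ∀ i < k, IsBooleanAt P B i := fun i hi => hB.isBooleanAt hE hn hB3 (by omega)
    rcases Nat.even_or_odd k with hev | hodd
    · rw [← (hBi (k - 1) (by omega)).1]
      exact eq_two_mul_of_even hev hk2 (fun i hi => (hBi i (by omega)).1) (hB.zero hn (by omega))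
        (hD.one hB hn (by omega)) (fun i h1 h2 => ih i h2 h1 (by omega)) (hB.pos hn (by omega))
        (hD.pos hn (by omega)) (hD.sum_eq_zero hB hE hn (by omega) (by omega))
    · rcases Nat.lt_or_ge k 5 with hk5 | hk5
      · obtain rfl : k = 3 := by
          obtain ⟨r, rfl⟩ := hodd
          omega
        exact hD3
      obtain ⟨y, hy⟩ := exists_grade_eq (P := P) hn (k := k) (by omega)
      have hDk : D k = #(atomsIn ⊥ y) * (k - 1).factorial := by
        rw [← (hBi (k - 1) (by omega)).1, hD.card_atomsIn_mul hB (by omega),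
          Nat.sub_add_cancel (by omega)]
      have hA : Even #(atomsIn ⊥ y) := by
        refine even_card_atomsIn hB (by omega) hy hBi fun z hz hz2 => ?_
        have g := grade_lt_of_lt hz
        refine hD.card_atomsIn_eq_two hB hn hz2 ?_
        rw [ih (grade ℕ z) (by omega) hz2 (by omega), (hBi (grade ℕ z - 1) (by omega)).1]
      rw [hDk, eq_two_of_odd hodd hk5 (fun i hi => (hBi i hi).1) (hB.factorial_le hE hn hB3 hk)
        (hD.one hB hn (by omega)) (fun i h1 h2 => ih i h2 h1 (by omega)) hDk hA
        (hD.pos hn (by omega)) (hD.pos hn (by omega))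
        (hD.sum_eq_zero hB hE hn (by omega) (by omega))]

theorem eq_two_mul_top (hD : IsShefferFactorialFunction P D)
    (hB : IsBinomialFactorialFunction P B) (hE : IsEulerianPoset P) (hn : grade ℕ (⊤ : P) = n)
    (hB3 : B 3 = 6) (hD3 : D 3 = 4) (hev : Even n) (hn2 : 2 ≤ n) : D n = 2 * B (n - 1) :=
  eq_two_mul_of_even hev hn2 (fun i hi => (hB.isBooleanAt hE hn hB3 (by omega)).1)
    (hB.zero hn (by omega)) (hD.one hB hn (by omega))
    (fun i h1 h2 => hD.eq_two_mul_factorial hB hE hn hB3 hD3 h1 h2) (hB.pos hn (by omega))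
    (hD.pos hn le_rfl) (hD.sum_eq_zero hB hE hn (by omega) le_rfl)

end IsShefferFactorialFunction

end Sheffer

/-! ### Order isomorphisms -/

section OrderIsos

/-- The pair `(i, S)` goes to the element whose atoms are the `e i s` with `s ∈ S`. Different copies
are incomparable because their atom sets are nonempty and disjoint. -/
theorem IsBooleanSum.nonempty_orderIso {P : Type*} [PartialOrder P] [GradeMinOrder ℕ P] [Fintype P]
    [DecidableEq P] {x y : P} {α k : ℕ} {e : Fin α → Fin k → P} (h : IsBooleanSum x y e) :
    Nonempty ((Σ _ : Fin α, Set.Ioo (⊥ : Finset (Fin k)) ⊤) ≃o Set.Ioo x y) := by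
  have hex : ∀ p : (Σ _ : Fin α, Set.Ioo (⊥ : Finset (Fin k)) ⊤),
      ∃ z : Set.Ioo x y, atomsIn x (z : P) = (p.2 : Finset (Fin k)).image (e p.1) := by
    rintro ⟨i, S, hS⟩
    obtain ⟨z, h1, h2, h3⟩ := h.exists_eq i S (Finset.nonempty_iff_ne_empty.2 hS.1.ne') hS.2.ne
    exact ⟨⟨z, h1, h2⟩, h3⟩
  choose g hg using hex
  have hinj : ∀ i, Function.Injective (e i) := fun i s t hst => (h.inj i s i t hst).2
  have hle : ∀ p q, g p ≤ g q ↔ p ≤ q := by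
    rintro ⟨i, S, hS⟩ ⟨j, T, hT⟩
    have h1 : g ⟨i, S, hS⟩ ≤ g ⟨j, T, hT⟩ ↔ S.image (e i) ⊆ T.image (e j) := by
      rw [← hg ⟨i, S, hS⟩, ← hg ⟨j, T, hT⟩]
      exact ⟨fun h' => atomsIn_mono h', h.le_of_subset _ _ (g _).2.1 (g _).2.2 (g _).2.1 (g _).2.2⟩
    rw [h1]
    constructor
    · intro hsub
      obtain ⟨s, hs⟩ := Finset.nonempty_iff_ne_empty.2 hS.1.ne'
      obtain ⟨t, -, hts⟩ := Finset.mem_image.1 (hsub (Finset.mem_image_of_mem _ hs))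
      obtain ⟨rfl, -⟩ := h.inj _ _ _ _ hts
      exact Sigma.LE.fiber j _ _ ((Finset.image_subset_image_iff (hinj j)).1 hsub)
    · rintro (⟨_, _, _, hab⟩)
      exact Finset.image_subset_image hab
  have hsurj : Function.Surjective g := by
    rintro ⟨z, hxz, hzy⟩
    obtain ⟨i, hi⟩ := h.exists_index z hxz hzy
    have himg : (univ.filter fun s => e i s ∈ atomsIn x z).image (e i) = atomsIn x z := by
      ext a
      simp only [Finset.mem_image, Finset.mem_filter, Finset.mem_univ, true_and]
      constructor
      · rintro ⟨s, hs, rfl⟩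
        exact hs
      · intro ha
        obtain ⟨s, rfl⟩ := hi a ha
        exact ⟨s, ha, rfl⟩
    have hS : (univ.filter fun s => e i s ∈ atomsIn x z) ∈ Set.Ioo (⊥ : Finset (Fin k)) ⊤ := by
      refine ⟨bot_lt_iff_ne_bot.2 fun h0 => ?_, lt_top_iff_ne_top.2 fun h0 => ?_⟩
      · have hne := atomsIn_nonempty hxz
        rw [← himg, h0] at hne
        simp at hne
      · have hlt := h.card_lt z hxz hzy
        rw [← himg, h0, Finset.card_image_of_injective _ (hinj i)] at hlt
        simp at hlt
    refine ⟨⟨i, _, hS⟩, Subtype.ext ?_⟩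
    have h2 := hg ⟨i, _, hS⟩
    rw [himg] at h2
    exact le_antisymm
      (h.le_of_subset _ _ (g _).2.1 (g _).2.2 hxz hzy h2.le)
      (h.le_of_subset _ _ hxz hzy (g _).2.1 (g _).2.2 h2.ge)
  exact ⟨RelIso.ofSurjective (OrderEmbedding.ofMapLEIff g hle) hsurj⟩

theorem nonempty_orderIso_withTop {P X : Type*} [PartialOrder P] [OrderTop P] [PartialOrder X]
    {a : P} (ha : a < ⊤) (φ : X ≃o Set.Ioo a ⊤) : Nonempty (WithTop X ≃o Set.Ioi a) := by
  let g : WithTop X → Set.Ioi a := fun t => WithTop.recTopCoe ⟨⊤, ha⟩ (fun x => ⟨φ x, (φ x).2.1⟩) t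
  have hle : ∀ s t, g s ≤ g t ↔ s ≤ t := by
    intro s t
    induction s using WithTop.recTopCoe with
    | top =>
      induction t using WithTop.recTopCoe with
      | top => exact iff_of_true le_rfl le_rfl
      | coe t =>
        refine iff_of_false (fun h => ?_) (by simp)
        exact (φ t).2.2.not_ge h
    | coe s =>
      induction t using WithTop.recTopCoe with
      | top => exact iff_of_true (le_top (α := P)) le_top
      | coe t => rw [WithTop.coe_le_coe, ← φ.le_iff_le]; rfl
  refine ⟨RelIso.ofSurjective (OrderEmbedding.ofMapLEIff g hle) ?_⟩
  rintro ⟨z, hz⟩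
  rcases eq_or_ne z ⊤ with rfl | hne
  · exact ⟨⊤, rfl⟩
  · obtain ⟨x, hx⟩ := φ.surjective ⟨z, hz, lt_top_iff_ne_top.2 hne⟩
    refine ⟨(x : WithTop X), Subtype.ext ?_⟩
    change ((φ x : Set.Ioo a ⊤) : P) = z
    rw [hx]

theorem nonempty_orderIso_Ioi_bot_withBot (X : Type*) [PartialOrder X] :
    Nonempty (X ≃o Set.Ioi (⊥ : WithBot X)) := by
  refine ⟨RelIso.ofSurjective (OrderEmbedding.ofMapLEIff
    (fun x : X => (⟨x, WithBot.bot_lt_coe x⟩ : Set.Ioi (⊥ : WithBot X)))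
    fun x y => WithBot.coe_le_coe) ?_⟩
  rintro ⟨z, hz⟩
  induction z using WithBot.recBotCoe with
  | bot => exact absurd (show (⊥ : WithBot X) < ⊥ from hz) (lt_irrefl _)
  | coe z => exact ⟨z, rfl⟩

/-- A poset in which every element other than `⊥` and two incomparable elements `a`, `b` lies above
`a` and `b` is a dual suspension. -/
theorem nonempty_orderIso_dualSuspension {P Q : Type*} [PartialOrder P] [OrderBot P]
    [PartialOrder Q] [OrderBot Q] {a b : P} (ha : a ≠ ⊥) (hb : b ≠ ⊥) (hab : ¬ a ≤ b)
    (hba : ¬ b ≤ a) (hba' : ∀ z, a < z → b < z) (hP : ∀ z, z = ⊥ ∨ z = a ∨ z = b ∨ a < z)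
    (φ : Set.Ioi (⊥ : Q) ≃o Set.Ioi a) : Nonempty (P ≃o DualSuspension Q) := by
  let f : (Unit ⊕ Unit) ⊕ Set.Ioi (⊥ : Q) → P :=
    Sum.elim (Sum.elim (fun _ => a) fun _ => b) fun t => φ t
  let g : DualSuspension Q → P := fun t => WithBot.recBotCoe ⊥ (fun s => f (ofLex s)) t
  have hf : ∀ s, f s ≠ ⊥ := by
    rintro ((_ | _) | t)
    · exact ha
    · exact hb
    · exact (bot_le.trans_lt (φ t).2).ne'
  have hle' : ∀ s t : (Unit ⊕ Unit) ⊕ₗ Set.Ioi (⊥ : Q), f (ofLex s) ≤ f (ofLex t) ↔ s ≤ t := by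
    intro s t
    rw [Sum.Lex.le_def]
    obtain ((s | s) | s) := s <;> obtain ((t | t) | t) := t
    · exact iff_of_true le_rfl (Sum.Lex.inl (Sum.LiftRel.inl le_rfl))
    · refine iff_of_false hab ?_
      rintro ⟨h⟩
      exact Sum.not_inl_le_inr h
    · exact iff_of_true (φ t).2.le (Sum.Lex.sep _ _)
    · refine iff_of_false hba ?_
      rintro ⟨h⟩
      exact Sum.not_inr_le_inl h
    · exact iff_of_true le_rfl (Sum.Lex.inl (Sum.LiftRel.inr le_rfl))
    · exact iff_of_true (hba' _ (φ t).2).le (Sum.Lex.sep _ _)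
    · refine iff_of_false (fun h => (φ s).2.not_ge h) ?_
      rintro ⟨⟩
    · refine iff_of_false (fun h => (hba' _ (φ s).2).not_ge h) ?_
      rintro ⟨⟩
    · refine Iff.trans ?_ (φ.le_iff_le.trans (Sum.lex_inr_inr).symm)
      rfl
  have hle : ∀ s t, g s ≤ g t ↔ s ≤ t := by
    intro s t
    induction s using WithBot.recBotCoe with
    | bot => exact iff_of_true (bot_le (α := P)) bot_le
    | coe s =>
      induction t using WithBot.recBotCoe with
      | bot => exact iff_of_false (fun h => hf _ (le_bot_iff.1 h)) (by simp)
      | coe t => exact (hle' s t).trans WithBot.coe_le_coe.symm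
  have hsurj : Function.Surjective g := by
    intro z
    rcases hP z with rfl | rfl | rfl | hz
    · exact ⟨⊥, rfl⟩
    · exact ⟨((toLex (Sum.inl (Sum.inl ())) : (Unit ⊕ Unit) ⊕ₗ Set.Ioi (⊥ : Q)) : WithBot _), rfl⟩
    · exact ⟨((toLex (Sum.inl (Sum.inr ())) : (Unit ⊕ Unit) ⊕ₗ Set.Ioi (⊥ : Q)) : WithBot _), rfl⟩
    · obtain ⟨t, ht⟩ := φ.surjective ⟨z, hz⟩
      refine ⟨((toLex (Sum.inr t) : (Unit ⊕ Unit) ⊕ₗ Set.Ioi (⊥ : Q)) : WithBot _), ?_⟩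
      change ((φ t : Set.Ioi a) : P) = z
      rw [ht]
  exact ⟨(RelIso.ofSurjective (OrderEmbedding.ofMapLEIff g hle) hsurj).symm⟩

end OrderIsos

/-! ### Assembling the isomorphism and the factorial functions -/

theorem mainTheorem4 {P : Type*} [PartialOrder P] [BoundedOrder P] [GradeMinOrder ℕ P]
    (m : ℕ) (hm : 4 ≤ 2 * m + 2) (hrank : grade ℕ (⊤ : P) = 2 * m + 2)
    (hE : IsEulerianPoset P) (hS : IsShefferPoset P)
    (B D : ℕ → ℕ) (hB : IsBinomialFactorialFunction P B) (hD : IsShefferFactorialFunction P D)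
    (hB3 : B 3 = 6) (hD3 : D 3 = 4) :
    ∃ α : ℕ, 0 < α ∧
      B (2 * m + 1) = α * (2 * m + 1).factorial ∧
      Nonempty (P ≃o DualSuspension (KSummation α (BooleanLattice (2 * m + 1)))) ∧
      (∀ k : ℕ, 1 ≤ k → k ≤ 2 * m → B k = k.factorial) ∧
      D 1 = 1 ∧
      (∀ k : ℕ, 2 ≤ k → k ≤ 2 * m + 1 → D k = 2 * (k - 1).factorial) ∧
      D (2 * m + 2) = 2 * α * (2 * m + 1).factorial := by
  classical
  have := hS.finite
  have := Fintype.ofFinite P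
  have hBk : ∀ k ≤ 2 * m, IsBooleanAt P B k := fun k hk =>
    hB.isBooleanAt hE hrank hB3 (by omega)
  have hDk : ∀ k : ℕ, 2 ≤ k → k ≤ 2 * m + 1 → D k = 2 * (k - 1).factorial := fun k h1 h2 =>
    hD.eq_two_mul_factorial hB hE hrank hB3 hD3 h1 (by omega)
  have hDtop : D (2 * m + 2) = 2 * B (2 * m + 1) :=
    hD.eq_two_mul_top hB hE hrank hB3 hD3 ⟨m + 1, by ring⟩ (by omega)
  have hatoms : ∀ z : P, 2 ≤ grade ℕ z → #(atomsIn ⊥ z) = 2 := by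
    intro z hz
    have g := grade_le_of_le (le_top : z ≤ ⊤)
    refine hD.card_atomsIn_eq_two hB hrank hz ?_
    rcases eq_or_ne (grade ℕ z) (2 * m + 2) with h | h
    · rw [h]; exact hDtop
    · rw [hDk _ hz (by omega), (hBk (grade ℕ z - 1) (by omega)).1]
  obtain ⟨a, b, hab, hatop⟩ := Finset.card_eq_two.1 (hatoms ⊤ (by omega))
  have ha : ⊥ ⋖ a := (mem_atomsIn.1 (show a ∈ atomsIn ⊥ (⊤ : P) by rw [hatop]; simp)).1
  have hb : ⊥ ⋖ b := (mem_atomsIn.1 (show b ∈ atomsIn ⊥ (⊤ : P) by rw [hatop]; simp)).1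
  have ga := grade_of_covBy ha
  have gb := grade_of_covBy hb
  rw [grade_bot_nat] at ga gb
  have habove : ∀ z : P, 2 ≤ grade ℕ z → a < z ∧ b < z := by
    intro z hz
    -- The two atoms below `z` are among the two atoms below `⊤`, hence are `a` and `b`.
    have h1 := Finset.eq_of_subset_of_card_le (atomsIn_mono (x := ⊥) (le_top : z ≤ ⊤))
      (by rw [hatoms z hz, hatoms ⊤ (by omega)])
    rw [hatop] at h1
    have h2 := (mem_atomsIn.1 (show a ∈ atomsIn ⊥ z by rw [h1]; simp)).2
    have h3 := (mem_atomsIn.1 (show b ∈ atomsIn ⊥ z by rw [h1]; simp)).2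
    exact ⟨lt_of_le_of_ne h2 (by rintro rfl; omega), lt_of_le_of_ne h3 (by rintro rfl; omega)⟩
  -- The interval `[a, ⊤]` has rank `2 * m + 1`, one more than the ranks at which intervals are
  -- forced to be boolean.
  obtain ⟨α, e, he, hα0, hα⟩ := hB.exists_isBooleanSum (k := 2 * m + 1)
    (fun i hi => hBk i (by omega)) hrank hB3 (by omega) (by omega) ha.lt.ne'
    (le_top : a ≤ ⊤) (by omega)
  refine ⟨α, hα0, hα, ?_, fun k _ hk => (hBk k hk).1, hD.one hB hrank (by omega), hDk, ?_⟩
  · obtain ⟨φ⟩ := he.nonempty_orderIso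
    obtain ⟨φ'⟩ := nonempty_orderIso_withTop (habove ⊤ (by omega)).1 φ
    obtain ⟨ψ⟩ := nonempty_orderIso_Ioi_bot_withBot
      (WithTop (Σ _ : Fin α, Set.Ioo (⊥ : BooleanLattice (2 * m + 1)) ⊤))
    refine nonempty_orderIso_dualSuspension ha.lt.ne' hb.lt.ne'
      (fun h => hab (eq_of_le_of_grade_eq h (by omega)))
      (fun h => hab (eq_of_le_of_grade_eq h (by omega)).symm)
      (fun z hz => (habove z (by have := grade_lt_of_lt hz; omega)).2) (fun z => ?_)
      (ψ.symm.trans φ')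
    rcases Nat.lt_or_ge (grade ℕ z) 2 with hz | hz
    · rcases eq_or_ne z ⊥ with rfl | hne
      · exact Or.inl rfl
      have h1 := grade_lt_of_lt (bot_lt_iff_ne_bot.2 hne)
      rw [grade_bot_nat] at h1
      have h2 : z ∈ atomsIn ⊥ (⊤ : P) :=
        mem_atomsIn.2 ⟨covBy_of_le_of_grade bot_le (by rw [grade_bot_nat]; omega), le_top⟩
      rw [hatop, Finset.mem_insert, Finset.mem_singleton] at h2
      rcases h2 with h2 | h2
      · exact Or.inr (Or.inl h2)
      · exact Or.inr (Or.inr (Or.inl h2))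
    · exact Or.inr (Or.inr (Or.inr (habove z hz).1))
  · rw [hDtop, hα, mul_assoc]
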